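/- For $N\ge 1$ let $S^{N-1}(\sqrt N)=\{v\in\mathbb R^N:\ \sum_{j=1}^N v_j^2=N\}$ and let $\sigma^N$ be the uniform probability measure on it. Let $\gamma(\mathrm dv)=(2\pi)^{-1/2}e^{-v^2/2}\,\mathrm dv$ be the standard Gaussian measure on $\mathbb R$. For probability measures $\mu,\nu$ on the same space, let $H(\mu|\nu)=\int h\log h\,\mathrm d\nu\in[0,+\infty]$ with $h=\mathrm d\mu/\mathrm d\nu$ if $\mu\ll\nu$, and $H(\mu|\nu)=+\infty$ otherwise. Let $f$ be a probability density on $\mathbb R$ such that $$\int_{\mathbb R} f(v)\,v^2\,\mathrm dv=1,\qquad \int_{\mathbb R} f(v)\,v^4\,\mathrm dv<+\infty,\qquad f\in L^\infty(\mathbb R),$$ and let $\nu(\mathrm dv)=f(v)\,\mathrm dv$. Let $\nu^{(N)}$ be the conditioned $N$-fold tensor product of $\nu$, i.e. the probability measure $$\nu^{(N)}=\frac{\prod_{j=1}^N f(v_j)}{Z_N}\,\sigma^N,\qquad Z_N=\int_{S^{N-1}(\sqrt N)}\prod_{j=1}^N f(v_j)\,\mathrm d\sigma^N(v),$$ which is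 well defined for all sufficiently large $N$. For each $N$ let $\mu^{(N)}$ be a probability measure on $S^{N-1}(\sqrt N)$, and suppose that $$\frac{H(\mu^{(N)}|\nu^{(N)})}{N}\xrightarrow[N\to\infty]{}0.$$ Then $$\frac{H(\mu^{(N)}|\sigma^N)}{N}\xrightarrow[N\to\infty]{}H(\nu|\gamma).$$ -/

import Mathlib

open MeasureTheory ProbabilityTheory InformationTheory Filter Topology
open scoped ENNReal

noncomputable section

namespace Kac

/-- The sphere `S^{N-1}(√N)` of radius `√N`, centred at the origin of Euclidean `ℝ^N`. -/
abbrev Sphere (N : ℕ) : Set (EuclideanSpace ℝ (Fin N)) :=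
  Metric.sphere 0 (Real.sqrt N)

/-- The dilation `x ↦ √N x` from the unit sphere to `S^{N-1}(√N)`. -/
def dilate (N : ℕ) (x : Metric.sphere (0 : EuclideanSpace ℝ (Fin N)) 1) : Sphere N :=
  ⟨Real.sqrt N • (x : EuclideanSpace ℝ (Fin N)), by
    simp [norm_smul, abs_of_nonneg (Real.sqrt_nonneg (N : ℝ))]⟩

/-- `σ^N`, the uniform probability measure on `S^{N-1}(√N)` (for `N ≥ 1`): the normalized surface
measure of the unit sphere, transported by the dilation of ratio `√N`. -/
def sigma (N : ℕ) : Measure (Sphere N) :=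
  (((volume : Measure (EuclideanSpace ℝ (Fin N))).toSphere Set.univ)⁻¹ •
    (volume : Measure (EuclideanSpace ℝ (Fin N))).toSphere).map (dilate N)

/-- The tensor product `f^{⊗N}(v) = ∏ⱼ f(vⱼ)`, restricted to `S^{N-1}(√N)`. -/
def tensor (f : ℝ → ℝ) (N : ℕ) (v : Sphere N) : ℝ≥0∞ :=
  ∏ j : Fin N, ENNReal.ofReal (f ((v : EuclideanSpace ℝ (Fin N)) j))

/-- The normalization `Z_N(f, √N) = ∫ f^{⊗N} dσ^N`. -/
def Z (f : ℝ → ℝ) (N : ℕ) : ℝ≥0∞ :=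
  ∫⁻ v, tensor f N v ∂(sigma N)

/-- The conditioned tensor product `[(f dv)^{⊗N}]` on `S^{N-1}(√N)`, that is
`f^{⊗N} / Z_N(f, √N) · σ^N`. -/
def conditioned (f : ℝ → ℝ) (N : ℕ) : Measure (Sphere N) :=
  (sigma N).withDensity fun v => tensor f N v / Z f N

/-- The measure `f(v) dv` on `ℝ`. -/
def densityMeasure (f : ℝ → ℝ) : Measure ℝ :=
  volume.withDensity fun v => ENNReal.ofReal (f v)

end Kac

end

noncomputable section

namespace Kac

open Set Real

/-! On the sphere, the chain rule for densities splits H(μ|σ) into H(μ|ν^(N)) + ∫ ∑ log f(v_j) dμ -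
log Z_N (`klDiv_sigma_eq`). After division by N the first term vanishes in the limit by hypothesis.
It remains to show that -log Z_N / N tends to (log 2π + 1)/2 and that the normalized mean of ∑ log
f(v_j) under μ tends to ∫ f log f. The two limits add up to H(ν|γ) because f has unit second moment.

Partition function. Integrating out a circle in two coordinates writes Z_N as a dimensional constant
times `slicedZ`, the integral of `circ` (N - s) against the (N-2)-fold convolution power of ρ, the
law of v². Boundedness of f bounds this above by a constant. From below a subexponential bound
suffices, so no local limit theorem is needed: by a Steinhaus argument ρ ∗ ρ dominates multiples of
Lebesgue measure on intervals on both sides of its mean. Combining these, a block of km factors has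
density at least d^m on an interval around its mean of length proportional to m. Chebyshev, which
uses the fourth moment of f, keeps the sum of the remaining factors close to its mean. With m ≈ δN
and δ small, the cost d^m is negligible (`eventually_le_slicedZ`). The dimensional constant cancels
against the Gaussian, whose tensor product is constant on the sphere.

Mean of log f. The entropy inequality bounds t ∫ ∑ log f dμ by H(μ|ν^(N)) plus the logarithm of an
exponential moment under ν^(N). That moment is Z(f^(1+t))/Z(f), at most exp(N Λ(t) + o(N)), with Λ
the cumulant generating function of log f under ν. Dividing by Nt and letting t tend to 0 from
either side yields Λ'(0) = ∫ f log f (`tendsto_integral_logTensor`). -/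

/-! ### Slicing the sphere: a circle in two coordinates over a ball in the others -/

lemma lintegral_mul_self_comp_sq (k : ℝ → ℝ≥0∞) (c : ℝ) :
    ∫⁻ r in Ioi (0 : ℝ), ENNReal.ofReal r * k r = 2⁻¹ * ∫⁻ u in Ioi c, k √(u - c) := by
  have himg : (fun r : ℝ => r ^ 2 + c) '' Ioi 0 = Ioi c := by
    ext u
    simp only [mem_image, mem_Ioi]
    constructor
    · rintro ⟨r, hr, rfl⟩
      have := pow_pos hr 2
      linarith
    · intro hu
      exact ⟨√(u - c), Real.sqrt_pos.2 (by linarith), by rw [Real.sq_sqrt (by linarith)]; ring⟩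
  have hinj : InjOn (fun r : ℝ => r ^ 2 + c) (Ioi 0) := by
    intro a ha b hb hab
    simp only [mem_Ioi] at ha hb
    have : a ^ 2 = b ^ 2 := by simpa using hab
    exact (pow_left_inj₀ ha.le hb.le two_ne_zero).1 this
  have h := lintegral_image_eq_lintegral_abs_deriv_mul (s := Ioi (0 : ℝ))
    (f := fun r : ℝ => r ^ 2 + c) (f' := fun r => 2 * r) measurableSet_Ioi
    (fun x _ => by
      simpa using ((hasDerivAt_pow 2 x).add_const c).hasDerivWithinAt) hinj (fun u => k √(u - c))
  rw [himg] at h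
  rw [h, ← lintegral_const_mul' _ _ (by simp)]
  refine setLIntegral_congr_fun measurableSet_Ioi fun r hr => ?_
  simp only [mem_Ioi] at hr
  simp only [add_sub_cancel_right, Real.sqrt_sq hr.le]
  rw [abs_of_pos (by linarith), ENNReal.ofReal_mul (by norm_num), ← mul_assoc, ← mul_assoc]
  congr 1
  simp [ENNReal.inv_mul_cancel]

/-- Polar coordinates in the plane, with the shifted squared radius `u = r ^ 2 + c` as variable. -/
lemma lintegral_plane {G : ℝ × ℝ → ℝ≥0∞} (hG : Measurable G) (c : ℝ) :
    ∫⁻ p, G p = 2⁻¹ * ∫⁻ u in Ioi c, ∫⁻ θ in Ioo (-π) π,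
      G (√(u - c) * cos θ, √(u - c) * sin θ) := by
  rw [← lintegral_comp_polarCoord_symm, polarCoord_target,
    Measure.volume_eq_prod, ← Measure.prod_restrict, lintegral_prod]
  · rw [← lintegral_mul_self_comp_sq (fun r => ∫⁻ θ in Ioo (-π) π, G (r * cos θ, r * sin θ)) c]
    refine lintegral_congr fun r => ?_
    rw [← lintegral_const_mul' _ _ (by simp)]
    simp [polarCoord_symm_apply]
  · simp only [polarCoord_symm_apply, smul_eq_mul]
    fun_prop

lemma lintegral_comp_smul_pi {n : ℕ} (k : (Fin n → ℝ) → ℝ≥0∞) {c : ℝ} (hc : 0 < c) :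
    ∫⁻ x, k x = ENNReal.ofReal (c ^ n) * ∫⁻ w, k (c • w) := by
  have hemb : MeasurableEmbedding fun w : Fin n → ℝ => c • w :=
    (Homeomorph.smulOfNeZero c hc.ne').measurableEmbedding
  rw [← hemb.lintegral_map, Measure.map_addHaar_smul _ hc.ne', lintegral_smul_measure,
    smul_eq_mul, ← mul_assoc, ← ENNReal.ofReal_mul (by positivity)]
  simp [abs_of_pos (inv_pos.2 (pow_pos hc n)), (pow_pos hc n).ne']

lemma lintegral_pi_succ {n : ℕ} {G : (Fin (n + 1) → ℝ) → ℝ≥0∞} (hG : Measurable G) :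
    ∫⁻ v, G v = ∫⁻ w, ∫⁻ a, G (Fin.cons a w) := by
  have h := (volume_preserving_piFinSuccAbove (fun _ : Fin (n + 1) => ℝ) 0).symm
  rw [← h.lintegral_comp hG, Measure.volume_eq_prod, lintegral_prod_symm]
  · simp [MeasurableEquiv.piFinSuccAbove_symm_apply, Fin.insertNthEquiv]
  · exact (hG.comp (MeasurableEquiv.measurable _)).aemeasurable

@[fun_prop]
lemma measurable_cons {α : Type*} [MeasurableSpace α] {n : ℕ} {a : α → ℝ} {w : α → Fin n → ℝ}
    (ha : Measurable a) (hw : Measurable w) :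
    Measurable fun x => (Fin.cons (a x) (w x) : Fin (n + 1) → ℝ) := by
  refine measurable_pi_lambda _ fun i => ?_
  refine Fin.cases ?_ (fun j => ?_) i
  · simpa using ha
  · simpa using measurable_pi_iff.1 hw j

lemma lintegral_pi_succ_succ {n : ℕ} {G : (Fin (n + 2) → ℝ) → ℝ≥0∞} (hG : Measurable G) :
    ∫⁻ v, G v = ∫⁻ w, ∫⁻ p : ℝ × ℝ, G (Fin.cons p.1 (Fin.cons p.2 w)) := by
  rw [lintegral_pi_succ hG, lintegral_pi_succ (by fun_prop)]
  refine lintegral_congr fun w => ?_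
  rw [Measure.volume_eq_prod, lintegral_prod_symm]
  fun_prop

/-- The point of the sphere of squared radius `s` over `w`, at angle `θ` in the first
two coordinates. -/
def lift {n : ℕ} (s : ℝ) (θ : ℝ) (w : Fin n → ℝ) : Fin (n + 2) → ℝ :=
  Fin.cons (√(s - ∑ i, w i ^ 2) * cos θ) (Fin.cons (√(s - ∑ i, w i ^ 2) * sin θ) w)

lemma measurable_lift {n : ℕ} : Measurable fun q : ℝ × ℝ × (Fin n → ℝ) => lift q.1 q.2.1 q.2.2 := by
  unfold lift
  fun_prop

lemma sum_sq_lift {n : ℕ} {s : ℝ} (θ : ℝ) {w : Fin n → ℝ} (h : ∑ i, w i ^ 2 ≤ s) :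
    ∑ i, lift s θ w i ^ 2 = s := by
  simp only [lift, Fin.sum_univ_succ, Fin.cons_zero, Fin.cons_succ, mul_pow,
    Real.sq_sqrt (sub_nonneg.2 h)]
  have := Real.sin_sq_add_cos_sq θ
  linear_combination (s - ∑ i, w i ^ 2) * this

lemma smul_lift {n : ℕ} {c : ℝ} (hc : 0 ≤ c) (s θ : ℝ) (w : Fin n → ℝ) :
    c • lift s θ w = lift (c ^ 2 * s) θ (c • w) := by
  have h : √(c ^ 2 * s - ∑ i, (c * w i) ^ 2) = c * √(s - ∑ i, w i ^ 2) := by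
    rw [← Real.sqrt_sq hc, ← Real.sqrt_mul (sq_nonneg _), Real.sqrt_sq hc]
    simp_rw [mul_pow, ← Finset.mul_sum, mul_sub]
  ext i
  refine Fin.cases ?_ (fun j => Fin.cases ?_ (fun k => ?_) j) i
  · simp [lift, h, mul_assoc]
  · simp [lift, h, mul_assoc]
  · simp [lift]

/-- Slicing of radial projections of Lebesgue measure on `ℝ^(n+2)`: the projection to the sphere of
squared radius `s` is, up to a constant, Lebesgue measure on the `n`-dimensional ball times
the uniform angle. -/
lemma lintegral_radial_projection {n : ℕ} {s : ℝ} (hs : 0 < s)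
    {F : (Fin (n + 2) → ℝ) → ℝ≥0∞} (hF : Measurable F) {ψ : ℝ → ℝ≥0∞} (hψ : Measurable ψ) :
    ∫⁻ v : Fin (n + 2) → ℝ, ψ (∑ i, v i ^ 2) * F (√(s / ∑ i, v i ^ 2) • v) =
      (2⁻¹ * ∫⁻ u in Ioi 0, ψ u * ENNReal.ofReal (√(u / s) ^ n)) *
        ∫⁻ w : Fin n → ℝ, if ∑ i, w i ^ 2 < s then ∫⁻ θ in Ioo (-π) π, F (lift s θ w) else 0 := by
  have hl := measurable_lift (n := n)
  have hm : Measurable fun q : ℝ × (Fin n → ℝ) =>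
      ∫⁻ θ in Ioo (-π) π, F (√(s / q.1) • lift q.1 θ q.2) := by
    refine Measurable.lintegral_prod_right' (f := fun q : (ℝ × (Fin n → ℝ)) × ℝ =>
      F (√(s / q.1.1) • lift q.1.1 q.2 q.1.2)) ?_
    have : Measurable fun q : (ℝ × (Fin n → ℝ)) × ℝ => lift q.1.1 q.2 q.1.2 :=
      hl.comp (by fun_prop : Measurable fun q : (ℝ × (Fin n → ℝ)) × ℝ => (q.1.1, q.2, q.1.2))
    fun_prop
  have key : ∀ w : Fin n → ℝ, ∫⁻ p : ℝ × ℝ, ψ (∑ i, (Fin.cons p.1 (Fin.cons p.2 w) :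
        Fin (n + 2) → ℝ) i ^ 2) * F (√(s / ∑ i, (Fin.cons p.1 (Fin.cons p.2 w) :
        Fin (n + 2) → ℝ) i ^ 2) • (Fin.cons p.1 (Fin.cons p.2 w) : Fin (n + 2) → ℝ)) =
      2⁻¹ * ∫⁻ u in Ioi 0, if ∑ i, w i ^ 2 < u then
        ψ u * ∫⁻ θ in Ioo (-π) π, F (√(s / u) • lift u θ w) else 0 := by
    intro w
    rw [lintegral_plane (by fun_prop) (∑ i, w i ^ 2)]
    congr 1
    have : ∀ u, (if ∑ i, w i ^ 2 < u then
        ψ u * ∫⁻ θ in Ioo (-π) π, F (√(s / u) • lift u θ w) else 0) =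
        (Ioi (∑ i, w i ^ 2)).indicator
          (fun u => ψ u * ∫⁻ θ in Ioo (-π) π, F (√(s / u) • lift u θ w)) u := by
      intro u; simp [indicator]
    simp_rw [this]
    rw [setLIntegral_indicator measurableSet_Ioi, inter_eq_left.2
      (Ioi_subset_Ioi (Finset.sum_nonneg fun i _ => sq_nonneg (w i)))]
    refine setLIntegral_congr_fun measurableSet_Ioi fun u hu => ?_
    have hu' : ∑ i, w i ^ 2 ≤ u := le_of_lt hu
    have e : ∀ θ, (Fin.cons (√(u - ∑ i, w i ^ 2) * cos θ)
      (Fin.cons (√(u - ∑ i, w i ^ 2) * sin θ) w) : Fin (n + 2) → ℝ) = lift u θ w := fun _ => rfl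
    simp only [e, sum_sq_lift _ hu']
    rw [lintegral_const_mul]
    have : Measurable fun θ => lift u θ w :=
      hl.comp (by fun_prop : Measurable fun θ : ℝ => (u, θ, w))
    fun_prop
  rw [lintegral_pi_succ_succ (by fun_prop)]
  simp_rw [key]
  have hset : MeasurableSet {q : (Fin n → ℝ) × ℝ | ∑ i, q.1 i ^ 2 < q.2} :=
    measurableSet_lt (by fun_prop) (by fun_prop)
  rw [lintegral_const_mul' _ _ (by simp), lintegral_lintegral_swap, mul_assoc]
  · congr 1
    have hw : Measurable fun w : Fin n → ℝ =>
        if ∑ i, w i ^ 2 < s then ∫⁻ θ in Ioo (-π) π, F (lift s θ w) else 0 := by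
      refine Measurable.ite (measurableSet_lt (by fun_prop) (by fun_prop)) ?_ measurable_const
      refine Measurable.lintegral_prod_right' (f := fun q : (Fin n → ℝ) × ℝ => F (lift s q.2 q.1)) ?_
      exact hF.comp (hl.comp (by fun_prop :
        Measurable fun q : (Fin n → ℝ) × ℝ => (s, q.2, q.1)))
    rw [← lintegral_mul_const _ (by fun_prop)]
    refine setLIntegral_congr_fun measurableSet_Ioi fun u hu => ?_
    simp only [mem_Ioi] at hu
    have hc : 0 < √(u / s) := Real.sqrt_pos.2 (by positivity)
    have hsq : √(u / s) ^ 2 = u / s := Real.sq_sqrt (by positivity)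
    have hinv : √(s / u) * √(u / s) = 1 := by
      rw [← Real.sqrt_mul (by positivity)]; field_simp; simp
    -- Rescaling w by √(u/s) carries the slice at squared radius u to the one at s; the Jacobian is
    -- the weight √(u/s)^n.
    rw [lintegral_comp_smul_pi _ hc, mul_assoc, mul_left_comm]
    rw [← lintegral_const_mul (ψ u) hw]
    congr 1
    refine lintegral_congr fun w => ?_
    have h1 : ∑ i, (√(u / s) • w) i ^ 2 < u ↔ ∑ i, w i ^ 2 < s := by
      simp only [Pi.smul_apply, smul_eq_mul, mul_pow, hsq, ← Finset.mul_sum]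
      rw [div_mul_eq_mul_div, div_lt_iff₀ hs, mul_lt_mul_iff_right₀ hu]
    have h2 : ∀ θ, √(s / u) • lift u θ (√(u / s) • w) = lift s θ w := by
      intro θ
      have : u = √(u / s) ^ 2 * s := by rw [hsq]; field_simp
      nth_rewrite 2 [this]
      rw [← smul_lift hc.le, smul_smul, hinv, one_smul]
    simp only [h1, h2]
    split_ifs <;> simp
  · refine (Measurable.ite hset ?_ measurable_const).aemeasurable
    exact (hψ.comp measurable_snd).mul (hm.comp measurable_swap)

/-- Polar coordinates off the origin, which is a null set. Cutting off at the unit ball makes the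
radial factor finite, so the surface integral can be recovered from a Lebesgue integral. -/
lemma lintegral_comp_radial {E : Type*} [NormedAddCommGroup E] [NormedSpace ℝ E]
    [MeasurableSpace E] [BorelSpace E] [FiniteDimensional ℝ E] [Nontrivial E]
    (μ : Measure E) [μ.IsAddHaarMeasure] {F : E → ℝ≥0∞} (hF : Measurable F) :
    ∫⁻ x, (Iio (1 : ℝ)).indicator 1 (‖x‖ ^ 2) * F (‖x‖⁻¹ • x) ∂μ =
      (∫⁻ ω : Metric.sphere (0 : E) 1, F ω ∂μ.toSphere) *
        Measure.volumeIoiPow (Module.finrank ℝ E - 1) (Iio ⟨1, mem_Ioi.2 one_pos⟩) := by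
  have hI : Measurable fun r : Ioi (0 : ℝ) => (Iio (1 : ℝ)).indicator (1 : ℝ → ℝ≥0∞) ((r : ℝ) ^ 2) :=
    (measurable_one.indicator measurableSet_Iio).comp (by fun_prop)
  have h0 : ∫⁻ x, (Iio (1 : ℝ)).indicator 1 (‖x‖ ^ 2) * F (‖x‖⁻¹ • x) ∂μ =
      ∫⁻ x : ({0}ᶜ : Set E), (Iio (1 : ℝ)).indicator 1 (‖(x : E)‖ ^ 2) * F (‖(x : E)‖⁻¹ • (x : E))
        ∂μ.comap (↑) := by
    rw [lintegral_subtype_comap (measurableSet_singleton _).compl fun x : E =>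
      (Iio (1 : ℝ)).indicator 1 (‖x‖ ^ 2) * F (‖x‖⁻¹ • x), restrict_compl_singleton]
  have h := μ.measurePreserving_homeomorphUnitSphereProd.lintegral_comp_emb
    (Homeomorph.measurableEmbedding _)
    (fun q => F q.1 * (Iio (1 : ℝ)).indicator 1 ((q.2 : ℝ) ^ 2))
  rw [lintegral_prod_mul (f := fun ω : Metric.sphere (0 : E) 1 => F ω)
    (hF.comp measurable_subtype_coe).aemeasurable hI.aemeasurable] at h
  have h2 : ∫⁻ r : Ioi (0 : ℝ), (Iio (1 : ℝ)).indicator (1 : ℝ → ℝ≥0∞) ((r : ℝ) ^ 2)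
      ∂Measure.volumeIoiPow (Module.finrank ℝ E - 1) =
      Measure.volumeIoiPow (Module.finrank ℝ E - 1) (Iio ⟨1, mem_Ioi.2 one_pos⟩) := by
    rw [← lintegral_indicator_one measurableSet_Iio]
    refine lintegral_congr fun r => ?_
    have hr : (0 : ℝ) < r := r.2
    have : (r : ℝ) ^ 2 < 1 ↔ r < (⟨1, mem_Ioi.2 one_pos⟩ : Ioi (0 : ℝ)) := by
      rw [← Subtype.coe_lt_coe, sq_lt_one_iff₀ hr.le]
    simp [indicator, this]
  rw [h2] at h
  rw [h0, ← h]
  refine lintegral_congr fun x => ?_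
  simp [mul_comm]

lemma measurable_dilate (N : ℕ) : Measurable (dilate N) := by
  unfold dilate
  fun_prop

lemma lintegral_sigma (N : ℕ) {F : Sphere N → ℝ≥0∞} (hF : Measurable F) :
    ∫⁻ v, F v ∂sigma N = ((volume : Measure (EuclideanSpace ℝ (Fin N))).toSphere univ)⁻¹ *
      ∫⁻ ω, F (dilate N ω) ∂(volume : Measure (EuclideanSpace ℝ (Fin N))).toSphere := by
  rw [sigma, lintegral_map hF (measurable_dilate N), lintegral_smul_measure, smul_eq_mul]

/-- Dimension zero is excluded: there the unit sphere is empty and `sigma` is the zero measure. -/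
instance isProbabilityMeasure_sigma (n : ℕ) : IsProbabilityMeasure (sigma (n + 1)) := by
  constructor
  rw [← lintegral_one, lintegral_sigma _ measurable_const, lintegral_one]
  refine ENNReal.inv_mul_cancel ?_ (measure_ne_top _ _)
  exact Measure.measure_univ_ne_zero.2
    (Measure.toSphere_ne_zero (volume : Measure (EuclideanSpace ℝ (Fin (n + 1)))))

/-- Slicing of the uniform measure on the sphere `S^{n+1}(√(n+2))`. -/
lemma exists_lintegral_sigma_eq (n : ℕ) : ∃ κ : ℝ≥0∞, κ ≠ 0 ∧ κ ≠ ∞ ∧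
    ∀ F : (Fin (n + 2) → ℝ) → ℝ≥0∞, Measurable F →
      ∫⁻ v, F (v : EuclideanSpace ℝ (Fin (n + 2))).ofLp ∂sigma (n + 2) =
        κ * ∫⁻ w : Fin n → ℝ, if ∑ i, w i ^ 2 < ((n + 2 : ℕ) : ℝ) then
          ∫⁻ θ in Ioo (-π) π, F (lift ((n + 2 : ℕ) : ℝ) θ w) else 0 := by
  set s : ℝ := ((n + 2 : ℕ) : ℝ) with hs
  have hs0 : 0 < s := by positivity
  set τ := (volume : Measure (EuclideanSpace ℝ (Fin (n + 2)))).toSphere with hτ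
  have hτ0 : τ univ ≠ 0 :=
    Measure.measure_univ_ne_zero.2
      (Measure.toSphere_ne_zero (volume : Measure (EuclideanSpace ℝ (Fin (n + 2)))))
  set b :=
    Measure.volumeIoiPow (Module.finrank ℝ (EuclideanSpace ℝ (Fin (n + 2))) - 1)
      (Iio ⟨1, mem_Ioi.2 one_pos⟩) with hb
  have hb0 : b ≠ 0 := by
    rw [hb, Measure.volumeIoiPow_apply_Iio, Ne, ENNReal.ofReal_eq_zero, not_le]
    positivity
  have hbt : b ≠ ∞ := by
    rw [hb, Measure.volumeIoiPow_apply_Iio]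
    exact ENNReal.ofReal_ne_top
  -- The radial profile is auxiliary; what matters is that both radial masses `b` and `d` are
  -- nonzero and finite.
  set ψ : ℝ → ℝ≥0∞ := (Iio (1 : ℝ)).indicator 1 with hψ
  have hψm : Measurable ψ := measurable_one.indicator measurableSet_Iio
  set d := 2⁻¹ * ∫⁻ u in Ioi 0, ψ u * ENNReal.ofReal (√(u / s) ^ n) with hd
  have hd' : d = 2⁻¹ * ∫⁻ u in Ioo 0 1, ENNReal.ofReal (√(u / s) ^ n) := by
    rw [hd]
    congr 1
    have : ∀ u, ψ u * ENNReal.ofReal (√(u / s) ^ n) =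
        (Iio (1 : ℝ)).indicator (fun u => ENNReal.ofReal (√(u / s) ^ n)) u := by
      intro u
      by_cases h : u < 1 <;> simp [ψ, h]
    simp_rw [this]
    rw [setLIntegral_indicator measurableSet_Iio, inter_comm, Ioi_inter_Iio]
  have hd0 : d ≠ 0 := by
    rw [hd']
    refine mul_ne_zero (by simp) (ne_of_gt ?_)
    rw [setLIntegral_pos_iff (by fun_prop)]
    have : Function.support (fun u => ENNReal.ofReal (√(u / s) ^ n)) ∩ Ioo 0 1 = Ioo 0 1 := by
      refine inter_eq_right.2 fun u hu => ?_
      have : 0 < √(u / s) := Real.sqrt_pos.2 (div_pos hu.1 hs0)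
      simp only [Function.mem_support, ne_eq, ENNReal.ofReal_eq_zero, not_le]
      positivity
    rw [this]
    simp
  have hdt : d ≠ ∞ := by
    rw [hd']
    refine ENNReal.mul_ne_top (by simp) (ne_of_lt ?_)
    refine (setLIntegral_mono measurable_const fun u hu => ENNReal.ofReal_le_ofReal
      (pow_le_pow_left₀ (Real.sqrt_nonneg _) (Real.sqrt_le_sqrt
        (div_le_div_of_nonneg_right hu.2.le hs0.le)) n)).trans_lt ?_
    rw [setLIntegral_const]
    exact ENNReal.mul_lt_top ENNReal.ofReal_lt_top (by simp)
  -- The first factor normalizes the surface measure, the second removes the radial mass of polar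
  -- coordinates, and the third is the radial mass produced by slicing.
  refine ⟨(τ univ)⁻¹ * b⁻¹ * d, ?_, ?_, ?_⟩
  · exact mul_ne_zero (mul_ne_zero (ENNReal.inv_ne_zero.2 (measure_ne_top _ _))
      (ENNReal.inv_ne_zero.2 hbt)) hd0
  · exact ENNReal.mul_ne_top (ENNReal.mul_ne_top (ENNReal.inv_ne_top.2 hτ0)
      (ENNReal.inv_ne_top.2 hb0)) hdt
  intro F hF
  have hofLp : Measurable fun x : EuclideanSpace ℝ (Fin (n + 2)) => x.ofLp :=
    (PiLp.volume_preserving_ofLp _).measurable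
  rw [lintegral_sigma _ (F := fun v : Sphere (n + 2) => F (v : EuclideanSpace ℝ (Fin (n + 2))).ofLp)
    (hF.comp (hofLp.comp measurable_subtype_coe)), mul_assoc, mul_assoc]
  congr 1
  have h1 := lintegral_comp_radial (volume : Measure (EuclideanSpace ℝ (Fin (n + 2))))
    (F := fun x => F (√s • x).ofLp) (hF.comp (hofLp.comp (measurable_const_smul _)))
  rw [← lintegral_radial_projection hs0 hF hψm,
    ← (PiLp.volume_preserving_ofLp (Fin (n + 2))).lintegral_comp (by fun_prop)]
  have h2 : ∀ x : EuclideanSpace ℝ (Fin (n + 2)),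
      ψ (∑ i, x.ofLp i ^ 2) * F (√(s / ∑ i, x.ofLp i ^ 2) • x.ofLp) =
      (Iio (1 : ℝ)).indicator 1 (‖x‖ ^ 2) * F (√s • (‖x‖⁻¹ • x)).ofLp := by
    intro x
    have : ∑ i, x.ofLp i ^ 2 = ‖x‖ ^ 2 := by
      rw [EuclideanSpace.norm_sq_eq]; simp
    rw [this, Real.sqrt_div hs0.le, Real.sqrt_sq (norm_nonneg _), smul_smul, div_eq_mul_inv]
    rfl
  rw [lintegral_congr h2, h1, mul_comm _ b, ← mul_assoc, ENNReal.inv_mul_cancel hb0 hbt, one_mul]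
  rfl

/-! ### The partition function through convolution powers, and its upper bound -/

/-- The law of `v ^ 2` under the measure with density `g`. -/
def sqLaw (g : ℝ → ℝ≥0∞) : Measure ℝ := (volume.withDensity g).map (· ^ 2)

/-- Unnormalized average of `g ⊗ g` over the circle of squared radius `u`. -/
def circ (g : ℝ → ℝ≥0∞) (u : ℝ) : ℝ≥0∞ :=
  if 0 < u then ∫⁻ θ in Ioo (-π) π, g (√u * cos θ) * g (√u * sin θ) else 0

/-- Iterated additive convolution of a measure on the line. -/
def convPow (ρ : Measure ℝ) : ℕ → Measure ℝ
  | 0 => Measure.dirac 0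
  | n + 1 => ρ ∗ convPow ρ n

variable {g : ℝ → ℝ≥0∞}

@[fun_prop]
lemma measurable_circ (hg : Measurable g) : Measurable (circ g) := by
  unfold circ
  refine Measurable.ite (measurableSet_lt measurable_const measurable_id) ?_ measurable_const
  exact Measurable.lintegral_prod_right'
    (f := fun q : ℝ × ℝ => g (√q.1 * cos q.2) * g (√q.1 * sin q.2)) (by fun_prop)

lemma lintegral_sqLaw (hg : Measurable g) {φ : ℝ → ℝ≥0∞} (hφ : Measurable φ) :
    ∫⁻ s, φ s ∂sqLaw g = ∫⁻ x, g x * φ (x ^ 2) := by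
  rw [sqLaw, lintegral_map hφ (by fun_prop),
    lintegral_withDensity_eq_lintegral_mul _ hg (by fun_prop)]
  rfl

instance sFinite_sqLaw : SFinite (sqLaw g) := by unfold sqLaw; infer_instance

instance sFinite_convPow (ρ : Measure ℝ) [SFinite ρ] (n : ℕ) : SFinite (convPow ρ n) := by
  induction n with
  | zero => unfold convPow; infer_instance
  | succ n ih => unfold convPow; infer_instance

lemma lintegral_convPow_sqLaw (hg : Measurable g) (n : ℕ) {φ : ℝ → ℝ≥0∞} (hφ : Measurable φ) :
    ∫⁻ s, φ s ∂convPow (sqLaw g) n = ∫⁻ w : Fin n → ℝ, (∏ i, g (w i)) * φ (∑ i, w i ^ 2) := by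
  induction n generalizing φ with
  | zero =>
    rw [convPow, lintegral_dirac' _ hφ]
    simp [volume_pi]
  | succ n ih =>
    rw [convPow, Measure.lintegral_conv hφ, lintegral_sqLaw hg
      (Measurable.lintegral_prod_right' (f := fun q : ℝ × ℝ => φ (q.1 + q.2)) (by fun_prop)),
      lintegral_pi_succ (by fun_prop), lintegral_lintegral_swap (by fun_prop)]
    refine lintegral_congr fun a => ?_
    rw [ih (by fun_prop), ← lintegral_const_mul _ (by fun_prop)]
    refine lintegral_congr fun w => ?_
    simp [Fin.prod_univ_succ, Fin.sum_univ_succ, mul_assoc]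

/-- Planar polar coordinates for the law of x² + y². Since `circ g` is thereby twice a density of a
convolution, almost everywhere information on `g` passes to `circ g`. -/
lemma sqLaw_conv_sqLaw (hg : Measurable g) :
    sqLaw g ∗ sqLaw g = volume.withDensity fun u => 2⁻¹ * circ g u := by
  refine Measure.ext_of_lintegral _ fun φ hφ => ?_
  rw [Measure.lintegral_conv hφ, lintegral_sqLaw hg
      (Measurable.lintegral_prod_right' (f := fun q : ℝ × ℝ => φ (q.1 + q.2)) (by fun_prop)),
    lintegral_withDensity_eq_lintegral_mul _ (by fun_prop) hφ]
  have h1 : ∀ x, g x * ∫⁻ t, φ (x ^ 2 + t) ∂sqLaw g =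
      ∫⁻ y, g x * (g y * φ (x ^ 2 + y ^ 2)) := fun x => by
    rw [lintegral_sqLaw hg (by fun_prop), lintegral_const_mul _ (by fun_prop)]
  simp_rw [h1]
  rw [← lintegral_prod (f := fun p : ℝ × ℝ => g p.1 * (g p.2 * φ (p.1 ^ 2 + p.2 ^ 2)))
    (by fun_prop), ← Measure.volume_eq_prod, lintegral_plane (by fun_prop) 0]
  simp only [Pi.mul_apply, mul_assoc]
  rw [lintegral_const_mul _ (by fun_prop)]
  congr 1
  rw [← lintegral_indicator measurableSet_Ioi]
  refine lintegral_congr fun u => ?_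
  by_cases hu : 0 < u
  · have : ∀ θ, (√u * cos θ) ^ 2 + (√u * sin θ) ^ 2 = u := fun θ => by
      have := Real.sin_sq_add_cos_sq θ
      rw [mul_pow, mul_pow, Real.sq_sqrt hu.le]
      linear_combination u * this
    simp only [circ, hu, if_true, indicator, mem_Ioi, sub_zero, this]
    rw [← lintegral_mul_const _ (by fun_prop)]
    simp_rw [mul_assoc]
  · simp [circ, hu, indicator]

lemma measurable_tensor {f : ℝ → ℝ} (hf : Measurable f) (N : ℕ) : Measurable (tensor f N) := by
  have : Measurable fun v : Sphere N => (v : EuclideanSpace ℝ (Fin N)).ofLp :=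
    (PiLp.volume_preserving_ofLp _).measurable.comp measurable_subtype_coe
  unfold tensor
  fun_prop

/-- The integral that is proportional to the partition function `Z`. -/
def slicedZ (g : ℝ → ℝ≥0∞) (n : ℕ) : ℝ≥0∞ :=
  ∫⁻ s, circ g (((n + 2 : ℕ) : ℝ) - s) ∂convPow (sqLaw g) n

/-- The partition function is proportional to `slicedZ`, with a constant that depends only on
the dimension. -/
lemma exists_Z_eq_mul_slicedZ (n : ℕ) : ∃ κ : ℝ≥0∞, κ ≠ 0 ∧ κ ≠ ∞ ∧
    ∀ f : ℝ → ℝ, Measurable f →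
      Z f (n + 2) = κ * slicedZ (fun x => ENNReal.ofReal (f x)) n := by
  obtain ⟨κ, h0, ht, h⟩ := exists_lintegral_sigma_eq n
  refine ⟨κ, h0, ht, fun f hf => ?_⟩
  have := h (fun v => ∏ j, ENNReal.ofReal (f (v j))) (by fun_prop)
  rw [Z]
  refine this.trans ?_
  rw [slicedZ, lintegral_convPow_sqLaw (by fun_prop) _
    (φ := fun s => circ (fun x => ENNReal.ofReal (f x)) (((n + 2 : ℕ) : ℝ) - s))
    ((measurable_circ (by fun_prop)).comp (by fun_prop))]
  congr 1
  refine lintegral_congr fun w => ?_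
  simp only [circ, sub_pos]
  split_ifs with hw
  · rw [← lintegral_const_mul _ (by fun_prop)]
    refine lintegral_congr fun θ => ?_
    simp only [lift, Fin.prod_univ_succ, Fin.cons_zero, Fin.cons_succ]
    ring
  · simp

/-- Apart from 0, the preimage of a null set is the union of its images under ±√, which are
differentiable on (0, ∞) and so preserve null sets. -/
lemma map_sq_absolutelyContinuous :
    (volume : Measure ℝ).map (· ^ 2) ≪ (volume : Measure ℝ) := by
  refine Measure.AbsolutelyContinuous.mk fun B hB h0 => ?_
  rw [Measure.map_apply (by fun_prop) hB]
  have hd : DifferentiableOn ℝ Real.sqrt (B ∩ Ioi 0) := fun x hx =>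
    (Real.hasDerivAt_sqrt (ne_of_gt hx.2)).differentiableAt.differentiableWithinAt
  have hB0 : volume (B ∩ Ioi 0) = 0 := measure_mono_null inter_subset_left h0
  have h1 := addHaar_image_eq_zero_of_differentiableOn_of_addHaar_eq_zero volume hd hB0
  have h2 := addHaar_image_eq_zero_of_differentiableOn_of_addHaar_eq_zero volume hd.neg hB0
  refine measure_mono_null (t := {0} ∪ (Real.sqrt '' (B ∩ Ioi 0) ∪ (-Real.sqrt) '' (B ∩ Ioi 0)))
    (fun x hx => ?_) (measure_union_null (by simp) (measure_union_null h1 h2))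
  rcases lt_trichotomy x 0 with h | h | h
  · exact Or.inr (Or.inr ⟨x ^ 2, ⟨hx, sq_pos_of_neg h⟩, by
      simp [Real.sqrt_sq_eq_abs, abs_of_neg h]⟩)
  · exact Or.inl h
  · exact Or.inr (Or.inl ⟨x ^ 2, ⟨hx, sq_pos_of_pos h⟩, Real.sqrt_sq h.le⟩)

lemma sqLaw_absolutelyContinuous : sqLaw g ≪ volume :=
  ((withDensity_absolutelyContinuous _ _).map (by fun_prop)).trans map_sq_absolutelyContinuous

lemma convPow_absolutelyContinuous {ρ : Measure ℝ} [SFinite ρ] (hρ : ρ ≪ volume) (n : ℕ) :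
    convPow ρ (n + 1) ≪ volume := by
  rw [convPow, Measure.conv_comm]
  exact Measure.conv_absolutelyContinuous hρ

lemma conv_mono {μ μ' ν ν' : Measure ℝ} [SFinite ν] [SFinite ν'] (hμ : μ ≤ μ') (hν : ν ≤ ν') :
    μ ∗ ν ≤ μ' ∗ ν' := by
  refine Measure.le_iff.2 fun s hs => ?_
  have hm : Measurable (s.indicator (1 : ℝ → ℝ≥0∞)) := measurable_one.indicator hs
  rw [← lintegral_indicator_one hs, ← lintegral_indicator_one hs,
    Measure.lintegral_conv hm, Measure.lintegral_conv hm]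
  exact lintegral_mono' hμ fun x => lintegral_mono' hν le_rfl

lemma sqLaw_mono {g' : ℝ → ℝ≥0∞} (h : g ≤ᵐ[volume] g') : sqLaw g ≤ sqLaw g' :=
  Measure.map_mono (withDensity_mono h) (by fun_prop)

lemma circ_const_le (C : ℝ≥0∞) (u : ℝ) : circ (fun _ => C) u ≤ ENNReal.ofReal (2 * π) * C ^ 2 := by
  unfold circ
  split_ifs
  · rw [setLIntegral_const, Real.volume_Ioo, mul_comm, sq]
    apply le_of_eq
    congr 2
    ring
  · simp

/-- A null set of the line could matter on an individual circle, so the bound cannot be checked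
circle by circle. Instead, monotonicity of convolution compares the integrals of `circ g` over
arbitrary sets with those for the constant function C. -/
lemma circ_le_of_ae_le (hg : Measurable g) {C : ℝ≥0∞} (hC : ∀ᵐ x, g x ≤ C) :
    ∀ᵐ u, circ g u ≤ ENNReal.ofReal (2 * π) * C ^ 2 := by
  refine ae_le_of_forall_setLIntegral_le_of_sigmaFinite (measurable_circ hg) fun s hs _ => ?_
  have h := conv_mono (sqLaw_mono hC) (sqLaw_mono hC) s
  rw [sqLaw_conv_sqLaw hg, sqLaw_conv_sqLaw measurable_const, withDensity_apply _ hs,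
    withDensity_apply _ hs, lintegral_const_mul _ (measurable_circ hg),
    lintegral_const_mul _ (measurable_circ measurable_const),
    ENNReal.mul_le_mul_iff_right (by simp) (by simp)] at h
  exact h.trans (lintegral_mono fun u => circ_const_le C u)

lemma convPow_univ (ρ : Measure ℝ) [SFinite ρ] (n : ℕ) : convPow ρ n univ = ρ univ ^ n := by
  induction n with
  | zero => simp [convPow]
  | succ n ih =>
    rw [convPow, ← lintegral_one, Measure.lintegral_conv measurable_const]
    simp [ih, pow_succ, mul_comm]

lemma sqLaw_univ : sqLaw g univ = ∫⁻ x, g x := by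
  rw [sqLaw, Measure.map_apply (by fun_prop) .univ]
  simp

/-- The almost everywhere bound on `circ` integrates against the convolution power only if that is
absolutely continuous; this excludes n = 0, where it is a Dirac mass. No normalization of `g` is
required, which later allows tilted densities. -/
lemma slicedZ_le (hg : Measurable g) {C : ℝ≥0∞} (hC : ∀ᵐ x, g x ≤ C) {n : ℕ} (hn : n ≠ 0) :
    slicedZ g n ≤ ENNReal.ofReal (2 * π) * C ^ 2 * (∫⁻ x, g x) ^ n := by
  obtain ⟨n, rfl⟩ := Nat.exists_eq_succ_of_ne_zero hn
  have h1 : ∀ᵐ s, circ g (((n + 1 + 2 : ℕ) : ℝ) - s) ≤ ENNReal.ofReal (2 * π) * C ^ 2 :=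
    (Measure.measurePreserving_sub_left volume (((n + 1 + 2 : ℕ) : ℝ))).quasiMeasurePreserving.ae
      (circ_le_of_ae_le hg hC)
  have h2 := (convPow_absolutelyContinuous (sqLaw_absolutelyContinuous (g := g)) n).ae_le h1
  refine (lintegral_mono_ae h2).trans ?_
  rw [lintegral_const, convPow_univ, sqLaw_univ]

/-! ### Lower bounds for convolutions by overlap of sets -/

section Overlap

/-- The convolution of the indicators of A and B at z is the measure of A ∩ (z - B). -/
lemma lintegral_restrict_conv_restrict {A B : Set ℝ} (hB : MeasurableSet B)
    {φ : ℝ → ℝ≥0∞} (hφ : Measurable φ) :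
    ∫⁻ z, φ z ∂(volume.restrict A ∗ volume.restrict B) =
      ∫⁻ z, φ z * volume (A ∩ {t | z - t ∈ B}) := by
  rw [Measure.lintegral_conv hφ]
  have h1 : ∀ x, ∫⁻ y in B, φ (x + y) = ∫⁻ z, B.indicator 1 (z - x) * φ z := by
    intro x
    rw [← lintegral_indicator hB, ← lintegral_add_left_eq_self
      (fun z => B.indicator (1 : ℝ → ℝ≥0∞) (z - x) * φ z) x]
    refine lintegral_congr fun y => ?_
    by_cases h : y ∈ B <;> simp [h]
  have hI : Measurable (B.indicator (1 : ℝ → ℝ≥0∞)) := measurable_one.indicator hB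
  simp_rw [h1]
  rw [lintegral_lintegral_swap (by fun_prop)]
  refine lintegral_congr fun z => ?_
  rw [lintegral_mul_const _ (by fun_prop), mul_comm]
  congr 1
  have hT : MeasurableSet {t | z - t ∈ B} := hB.preimage (by fun_prop)
  have : ∀ t, B.indicator (1 : ℝ → ℝ≥0∞) (z - t) = {t | z - t ∈ B}.indicator 1 t := fun t => by
    by_cases h : z - t ∈ B <;> simp [h]
  simp_rw [this]
  rw [lintegral_indicator_one hT, Measure.restrict_apply hT, inter_comm]

lemma smul_restrict_le_conv {μ₁ μ₂ : Measure ℝ} [SFinite μ₂] {A B U : Set ℝ}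
    (hB : MeasurableSet B) (hU : MeasurableSet U) {c₁ c₂ δ : ℝ≥0∞}
    (h₁ : c₁ • volume.restrict A ≤ μ₁) (h₂ : c₂ • volume.restrict B ≤ μ₂)
    (hδ : ∀ z ∈ U, δ ≤ volume (A ∩ {t | z - t ∈ B})) :
    (c₁ * c₂ * δ) • volume.restrict U ≤ μ₁ ∗ μ₂ := by
  refine le_trans ?_ (conv_mono h₁ h₂)
  rw [Measure.conv_smul_left, Measure.conv_comm, Measure.conv_smul_left, Measure.conv_comm,
    smul_smul, mul_smul]
  have : δ • volume.restrict U ≤ volume.restrict A ∗ volume.restrict B := by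
    refine Measure.le_iff.2 fun s hs => ?_
    have hm : Measurable (s.indicator (1 : ℝ → ℝ≥0∞)) := measurable_one.indicator hs
    rw [← lintegral_indicator_one (μ := _ ∗ _) hs, lintegral_restrict_conv_restrict hB hm,
      Measure.smul_apply, smul_eq_mul, Measure.restrict_apply hs,
      ← lintegral_indicator_one (hs.inter hU), ← lintegral_const_mul _
        (measurable_one.indicator (hs.inter hU))]
    refine lintegral_mono fun z => ?_
    by_cases hz : z ∈ s
    · by_cases hz' : z ∈ U
      · simpa [hz, hz'] using hδ z hz'
      · simp [hz']
    · simp [hz]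
  refine Measure.le_iff.2 fun s hs => ?_
  have := this s
  simp only [Measure.smul_apply, smul_eq_mul] at this ⊢
  gcongr

lemma le_volume_ball_inter {x₁ x₂ r₁ r₂ s z : ℝ} (h₁ : s ≤ 2 * r₁) (h₂ : s ≤ 2 * r₂)
    (hz : z ∈ Metric.ball (x₁ + x₂) (r₁ + r₂ - s)) :
    ENNReal.ofReal s ≤ volume (Metric.ball x₁ r₁ ∩ {t | z - t ∈ Metric.ball x₂ r₂}) := by
  rw [Metric.mem_ball, Real.dist_eq, abs_lt] at hz
  have hsub : Ioo (max (x₁ - r₁) (z - x₂ - r₂)) (min (x₁ + r₁) (z - x₂ + r₂)) ⊆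
      Metric.ball x₁ r₁ ∩ {t | z - t ∈ Metric.ball x₂ r₂} := by
    intro t ht
    simp only [mem_Ioo, max_lt_iff, lt_min_iff] at ht
    simp only [mem_inter_iff, mem_ofPred_eq, Metric.mem_ball, Real.dist_eq, abs_lt]
    refine ⟨⟨?_, ?_⟩, ?_, ?_⟩ <;> linarith [ht.1.1, ht.1.2, ht.2.1, ht.2.2]
  refine le_trans ?_ (measure_mono hsub)
  rw [Real.volume_Ioo]
  refine ENNReal.ofReal_le_ofReal ?_
  rw [le_sub_iff_add_le, le_min_iff]
  constructor <;> rw [← le_sub_iff_add_le', max_le_iff] <;> constructor <;> linarith [hz.1, hz.2]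

lemma smul_restrict_ball_le_conv {μ₁ μ₂ : Measure ℝ} [SFinite μ₂] {x₁ x₂ r₁ r₂ s : ℝ}
    {c₁ c₂ : ℝ≥0∞} (h₁ : c₁ • volume.restrict (Metric.ball x₁ r₁) ≤ μ₁)
    (h₂ : c₂ • volume.restrict (Metric.ball x₂ r₂) ≤ μ₂) (hs₁ : s ≤ 2 * r₁) (hs₂ : s ≤ 2 * r₂) :
    (c₁ * c₂ * ENNReal.ofReal s) • volume.restrict (Metric.ball (x₁ + x₂) (r₁ + r₂ - s)) ≤
      μ₁ ∗ μ₂ :=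
  smul_restrict_le_conv measurableSet_ball measurableSet_ball h₁ h₂
    fun _ hz => le_volume_ball_inter hs₁ hs₂ hz

/-- A quantitative version of the Steinhaus theorem. -/
lemma exists_le_volume_inter_sub_mem {A : Set ℝ} (hA : MeasurableSet A) (h0 : volume A ≠ 0) :
    ∃ x ∈ A, ∃ r > 0, ∀ z ∈ Metric.ball (2 * x) (r / 2),
      ENNReal.ofReal r ≤ volume (A ∩ {t | z - t ∈ A}) := by
  have hne : (ae (volume.restrict A)).NeBot := by
    rw [ae_neBot]
    simpa using h0
  obtain ⟨x, hx, hxA⟩ :=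
    ((Besicovitch.ae_tendsto_measure_inter_div volume A).and (ae_restrict_mem hA)).exists
  -- At a density point, A fills more than 7/8 of a small ball, that is, measure at least 7r/4. The
  -- reflected copy is centred within r/2 of x, so both lie in an interval of length at most 5r/2
  -- and overlap in measure at least 7r/4 + 7r/4 - 5r/2 = r.
  have hev := (hx.eventually (lt_mem_nhds (ENNReal.ofReal_lt_one.2
    (show (7 / 8 : ℝ) < 1 by norm_num)))).and self_mem_nhdsWithin
  obtain ⟨r, hr, hr0⟩ := hev.exists
  replace hr0 : 0 < r := hr0
  refine ⟨x, hxA, r, hr0, fun z hz => ?_⟩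
  set S := A ∩ Metric.closedBall x r with hS
  have hSm : MeasurableSet S := hA.inter measurableSet_closedBall
  set T := {t | z - t ∈ S} with hT
  have hTm : MeasurableSet T := hSm.preimage (by fun_prop)
  have hvS : ENNReal.ofReal (7 / 4 * r) ≤ volume S := by
    rw [Real.volume_closedBall] at hr
    have := (ENNReal.lt_div_iff_mul_lt (Or.inl (by simpa using hr0))
      (Or.inl ENNReal.ofReal_ne_top)).1 hr
    rw [← ENNReal.ofReal_mul (by norm_num)] at this
    refine le_trans (le_of_eq ?_) this.le
    congr 1
    ring
  have hvT : volume T = volume S :=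
    (Measure.measurePreserving_sub_left volume z).measure_preimage hSm.nullMeasurableSet
  rw [Metric.mem_ball, Real.dist_eq, abs_lt] at hz
  have hU : volume (S ∪ T) ≤ ENNReal.ofReal (5 / 2 * r) := by
    have hsub : S ∪ T ⊆ Icc (min (x - r) (z - x - r)) (max (x + r) (z - x + r)) := by
      have aux : ∀ t, t ∈ Metric.closedBall x r → x - r ≤ t ∧ t ≤ x + r := fun t ht => by
        rw [Metric.mem_closedBall, Real.dist_eq, abs_le] at ht
        constructor <;> linarith [ht.1, ht.2]
      rintro t (ht | ht)
      · obtain ⟨h1, h2⟩ := aux _ ht.2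
        exact ⟨min_le_of_left_le h1, le_max_of_le_left h2⟩
      · obtain ⟨h1, h2⟩ := aux _ ht.2
        exact ⟨min_le_of_right_le (by linarith), le_max_of_le_right (by linarith)⟩
    refine (measure_mono hsub).trans ?_
    rw [Real.volume_Icc]
    refine ENNReal.ofReal_le_ofReal ?_
    rcases max_cases (x + r) (z - x + r) with h | h <;>
      rcases min_cases (x - r) (z - x - r) with h' | h' <;> linarith [h.1, h.2, h'.1, h'.2]
  have hsum := measure_union_add_inter (μ := volume) S hTm
  rw [hvT] at hsum
  have h7 : ENNReal.ofReal (5 / 2 * r) + ENNReal.ofReal r ≤ ENNReal.ofReal (5 / 2 * r) +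
      volume (S ∩ T) := by
    calc ENNReal.ofReal (5 / 2 * r) + ENNReal.ofReal r
        = ENNReal.ofReal (7 / 4 * r) + ENNReal.ofReal (7 / 4 * r) := by
          rw [← ENNReal.ofReal_add (by positivity) hr0.le,
            ← ENNReal.ofReal_add (by positivity) (by positivity)]
          congr 1
          ring
      _ ≤ volume S + volume S := add_le_add hvS hvS
      _ = volume (S ∪ T) + volume (S ∩ T) := hsum.symm
      _ ≤ _ := add_le_add_left hU _
  refine ((ENNReal.add_le_add_iff_left ENNReal.ofReal_ne_top).1 h7).trans (measure_mono ?_)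
  rintro t ⟨h1, h2⟩
  exact ⟨h1.1, h2.1⟩

/-- The sets where the density exceeds 1/n exhaust the set where it is positive, so one of them
meets I in positive measure. -/
lemma exists_smul_restrict_le {ρ : Measure ℝ} [SigmaFinite ρ] (hρ : ρ ≪ volume) {I : Set ℝ}
    (hI : MeasurableSet I) (h0 : ρ I ≠ 0) :
    ∃ A ⊆ I, MeasurableSet A ∧ volume A ≠ 0 ∧ ∃ c : ℝ≥0∞, c ≠ 0 ∧ c • volume.restrict A ≤ ρ := by
  set h := ρ.rnDeriv volume
  have hh : Measurable h := Measure.measurable_rnDeriv _ _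
  have hd : volume.withDensity h = ρ := Measure.withDensity_rnDeriv_eq _ _ hρ
  have hA : ∀ n : ℕ, MeasurableSet (I ∩ {x | (n : ℝ≥0∞)⁻¹ < h x}) := fun n =>
    hI.inter (measurableSet_lt measurable_const hh)
  by_cases hn : ∀ n : ℕ, volume (I ∩ {x | (n : ℝ≥0∞)⁻¹ < h x}) = 0
  · refine absurd ?_ h0
    rw [← hd, withDensity_apply _ hI]
    refine (lintegral_eq_zero_iff hh).2 ?_
    refine (ae_restrict_iff' hI).2 ?_
    have := ae_all_iff.2 fun n => measure_eq_zero_iff_ae_notMem.1 (hn n)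
    filter_upwards [this] with x hx hxI
    by_contra hne
    obtain ⟨n, hn⟩ := ENNReal.exists_inv_nat_lt hne
    exact hx n ⟨hxI, hn⟩
  · push Not at hn
    obtain ⟨n, hn⟩ := hn
    refine ⟨_, inter_subset_left, hA n, hn, (n : ℝ≥0∞)⁻¹, by simp, ?_⟩
    refine Measure.le_iff.2 fun s hs => ?_
    rw [Measure.smul_apply, smul_eq_mul, Measure.restrict_apply hs, ← setLIntegral_const]
    calc _ ≤ ∫⁻ x in s ∩ (I ∩ {x | (n : ℝ≥0∞)⁻¹ < h x}), h x :=
          setLIntegral_mono hh fun x hx => hx.2.2.le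
      _ ≤ ∫⁻ x in s, h x := lintegral_mono_set inter_subset_left
      _ = ρ s := by rw [← withDensity_apply _ hs, hd]

lemma exists_smul_restrict_ball_le_conv_self {ρ : Measure ℝ} [SigmaFinite ρ] (hρ : ρ ≪ volume)
    {I : Set ℝ} (hI : MeasurableSet I) (h0 : ρ I ≠ 0) :
    ∃ x ∈ I, ∃ r > 0, ∃ c : ℝ≥0∞, c ≠ 0 ∧
      c • volume.restrict (Metric.ball (2 * x) r) ≤ ρ ∗ ρ := by
  obtain ⟨A, hAI, hA, hA0, c, hc, hle⟩ := exists_smul_restrict_le hρ hI h0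
  obtain ⟨x, hx, r, hr, h⟩ := exists_le_volume_inter_sub_mem hA hA0
  exact ⟨x, hAI hx, r / 2, by positivity, c * c * ENNReal.ofReal r, by simp [hc, hr],
    smul_restrict_le_conv hA measurableSet_ball hle hle h⟩

end Overlap

/-! ### Growth of intervals under convolution powers -/

section ConvPow

variable {ρ : Measure ℝ}

lemma convPow_add [SFinite ρ] (m n : ℕ) : convPow ρ (m + n) = convPow ρ m ∗ convPow ρ n := by
  induction m with
  | zero => simp [convPow]
  | succ m ih => rw [Nat.succ_add, convPow, ih, convPow, Measure.conv_assoc]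

lemma convPow_one [SFinite ρ] : convPow ρ 1 = ρ := by simp [convPow]

lemma convPow_two [SFinite ρ] : convPow ρ 2 = ρ ∗ ρ := by
  rw [convPow, convPow_one]

/-- With no mass on one side of the mean, x - 1 has a constant sign and zero integral, hence ρ is
concentrated at 1; but points are null. -/
lemma ne_zero_Iio_and_Ioi [IsProbabilityMeasure ρ] (hρ : ρ ≪ volume) (hi : Integrable id ρ)
    (h1 : ∫ x, x ∂ρ = 1) : ρ (Iio 1) ≠ 0 ∧ ρ (Ioi 1) ≠ 0 := by
  have hs : ρ {1} = 0 := hρ (by simp)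
  replace hi : Integrable (fun x : ℝ => x) ρ := hi
  have hint : ∫ x, (x - 1) ∂ρ = 0 := by
    rw [integral_sub hi (integrable_const _), h1]
    simp
  have hint' : ∫ x, (1 - x) ∂ρ = 0 := by
    rw [integral_sub (integrable_const _) hi, h1]
    simp
  have hne : ¬ ∀ᵐ x ∂ρ, x = 1 := fun h => by
    have h2 : ∀ᵐ x ∂ρ, x ≠ 1 := measure_eq_zero_iff_ae_notMem.1 hs
    exact (h.and h2).exists.elim fun x hx => hx.2 hx.1
  constructor
  · intro h
    have hle : ∀ᵐ x ∂ρ, x ∉ Iio (1 : ℝ) := measure_eq_zero_iff_ae_notMem.1 h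
    refine hne ?_
    filter_upwards [(integral_eq_zero_iff_of_nonneg_ae (f := fun x => x - 1)
      (by filter_upwards [hle] with x hx; simpa using hx)
      (hi.sub (integrable_const _))).1 hint] with x hx
    simpa [sub_eq_zero] using hx
  · intro h
    have hle : ∀ᵐ x ∂ρ, x ∉ Ioi (1 : ℝ) := measure_eq_zero_iff_ae_notMem.1 h
    refine hne ?_
    filter_upwards [(integral_eq_zero_iff_of_nonneg_ae (f := fun x => 1 - x)
      (by filter_upwards [hle] with x hx; simpa using hx)
      ((integrable_const _).sub hi)).1 hint'] with x hx
    have : 1 - x = 0 := hx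
    linarith

lemma smul_restrict_ball_mono {μ : Measure ℝ} {c c' : ℝ≥0∞} {x x' r r' : ℝ} (hc : c' ≤ c)
    (hb : Metric.ball x' r' ⊆ Metric.ball x r) (h : c • volume.restrict (Metric.ball x r) ≤ μ) :
    c' • volume.restrict (Metric.ball x' r') ≤ μ := by
  refine le_trans ?_ h
  refine Measure.le_iff.2 fun s _ => ?_
  simp only [Measure.smul_apply, smul_eq_mul]
  exact mul_le_mul' hc (Measure.restrict_mono hb le_rfl s)

/-- Convolving with a ball of radius r while giving up r/2 of the radius costs a factor c r/2 and
still gains r/2, so radii grow linearly and constants decay only exponentially. The minimum with 1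
lets the same constant serve the base case. -/
lemma smul_restrict_ball_le_convPow [SFinite ρ] {x y r : ℝ} (hr : 0 < r) {c : ℝ≥0∞}
    (hx : c • volume.restrict (Metric.ball x r) ≤ convPow ρ 2)
    (hy : c • volume.restrict (Metric.ball y r) ≤ convPow ρ 2) (k : ℕ) :
    ∀ i j : ℕ, i + j = k + 1 →
      ((c * ENNReal.ofReal (min 1 (r / 2))) ^ (k + 1)) •
        volume.restrict (Metric.ball (i * x + j * y) ((k + 1 : ℕ) * (r / 2))) ≤
        convPow ρ (2 * (k + 1)) := by
  have hd1 : c * ENNReal.ofReal (min 1 (r / 2)) ≤ c := by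
    refine mul_le_of_le_one_right' ?_
    simp
  have hd2 : c * ENNReal.ofReal (min 1 (r / 2)) ≤ c * ENNReal.ofReal (r / 2) := by
    gcongr
    exact min_le_right _ _
  induction k with
  | zero =>
    intro i j hij
    have hb : ∀ z : ℝ, Metric.ball z (((0 + 1 : ℕ) : ℝ) * (r / 2)) ⊆ Metric.ball z r := fun z =>
      Metric.ball_subset_ball (by push_cast; linarith)
    rcases Nat.eq_zero_or_pos i with rfl | hi
    · obtain rfl : j = 1 := by omega
      simpa using smul_restrict_ball_mono hd1 (hb y) hy
    · obtain rfl : i = 1 := by omega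
      obtain rfl : j = 0 := by omega
      simpa using smul_restrict_ball_mono hd1 (hb x) hx
  | succ k ih =>
    have step : ∀ w : ℝ, c • volume.restrict (Metric.ball w r) ≤ convPow ρ 2 → ∀ X : ℝ,
        ((c * ENNReal.ofReal (min 1 (r / 2))) ^ (k + 1)) •
        volume.restrict (Metric.ball X ((k + 1 : ℕ) * (r / 2))) ≤ convPow ρ (2 * (k + 1)) →
        ((c * ENNReal.ofReal (min 1 (r / 2))) ^ (k + 1 + 1)) •
        volume.restrict (Metric.ball (w + X) ((k + 1 + 1 : ℕ) * (r / 2))) ≤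
          convPow ρ (2 * (k + 1 + 1)) := by
      intro w hw X hX
      have e : 2 * (k + 1 + 1) = 2 + 2 * (k + 1) := by ring
      rw [e, convPow_add]
      have hk : (0 : ℝ) ≤ k := Nat.cast_nonneg k
      refine smul_restrict_ball_mono ?_ ?_ (smul_restrict_ball_le_conv (s := r / 2) hw hX
        (by linarith) (by push_cast; nlinarith))
      · rw [pow_succ']
        exact (mul_le_mul' hd2 le_rfl).trans_eq (mul_right_comm _ _ _)
      · refine Metric.ball_subset_ball ?_
        push_cast
        linarith
    intro i j hij
    rcases Nat.eq_zero_or_pos i with rfl | hi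
    · obtain rfl : j = k + 1 + 1 := by omega
      have := step y hy _ (ih 0 (k + 1) (by simp))
      convert this using 4
      push_cast
      ring
    · obtain ⟨i, rfl⟩ := Nat.exists_eq_succ_of_ne_zero hi.ne'
      have := step x hx _ (ih i j (by omega))
      convert this using 4
      push_cast
      ring

lemma exists_nat_combination {x y r : ℝ} (hx : x < 2) (hy : 2 < y) (hr : 0 < r) :
    ∃ i j : ℕ, 0 < i + j ∧ |i * x + j * y - 2 * (i + j)| ≤ (i + j) * r := by
  obtain ⟨K, hK⟩ := exists_nat_gt ((y - x) / r)
  have hK0 : (0 : ℝ) < K := lt_of_le_of_lt (div_nonneg (by linarith) hr.le) hK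
  rw [div_lt_iff₀ hr] at hK
  -- This weight solves l x + (1 - l) y = 2. Rounding K l down moves the combination by at most y -
  -- x, which is below K r by the choice of K.
  set l := (y - 2) / (y - x) with hl
  have hxy : 0 < y - x := by linarith
  have hl0 : 0 ≤ l := div_nonneg (by linarith) hxy.le
  have hl1 : l ≤ 1 := (div_le_one hxy).2 (by linarith)
  have hle : (⌊K * l⌋₊ : ℝ) ≤ K * l := Nat.floor_le (by positivity)
  have hlt : K * l < ⌊K * l⌋₊ + 1 := Nat.lt_floor_add_one _
  have hiK : ⌊K * l⌋₊ ≤ K := by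
    have : (⌊K * l⌋₊ : ℝ) ≤ K := hle.trans (by nlinarith)
    exact_mod_cast this
  refine ⟨⌊K * l⌋₊, K - ⌊K * l⌋₊, ?_, ?_⟩
  · rw [Nat.add_sub_cancel' hiK]
    exact_mod_cast hK0
  · rw [Nat.cast_sub hiK, add_sub_cancel]
    have hlxy : l * (y - x) = y - 2 := by rw [hl]; field_simp
    have : (⌊K * l⌋₊ : ℝ) * x + (K - ⌊K * l⌋₊) * y - 2 * K = (K * l - ⌊K * l⌋₊) * (y - x) := by
      linear_combination (-(K : ℝ)) * hlxy
    rw [this, abs_of_nonneg (mul_nonneg (by linarith) hxy.le)]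
    nlinarith

/-- Convolution powers of an absolutely continuous law of mean one have a density that is at
least exponentially large on an interval around the mean of linearly growing length. -/
lemma exists_smul_restrict_ball_le_convPow [IsProbabilityMeasure ρ] (hρ : ρ ≪ volume)
    (hi : Integrable id ρ) (h1 : ∫ x, x ∂ρ = 1) :
    ∃ k : ℕ, 0 < k ∧ ∃ d : ℝ, 0 < d ∧ d ≤ 1 ∧ ∃ η : ℝ, 0 < η ∧ ∀ m : ℕ, 0 < m →
      ENNReal.ofReal (d ^ m) • volume.restrict (Metric.ball ((k * m : ℕ) : ℝ) (m * η)) ≤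
        convPow ρ (k * m) := by
  obtain ⟨hl, hu⟩ := ne_zero_Iio_and_Ioi hρ hi h1
  obtain ⟨x, hx, rx, hrx, cx, hcx, hX⟩ :=
    exists_smul_restrict_ball_le_conv_self hρ measurableSet_Iio hl
  obtain ⟨y, hy, ry, hry, cy, hcy, hY⟩ :=
    exists_smul_restrict_ball_le_conv_self hρ measurableSet_Ioi hu
  simp only [mem_Iio, mem_Ioi] at hx hy
  rw [← convPow_two] at hX hY
  set r := min rx ry with hr
  have hr0 : 0 < r := lt_min hrx hry
  set c := min cx cy with hc
  have hc0 : c ≠ 0 := by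
    rw [hc, ← pos_iff_ne_zero]
    exact lt_min (pos_iff_ne_zero.2 hcx) (pos_iff_ne_zero.2 hcy)
  have hX' := smul_restrict_ball_mono (min_le_left cx cy)
    (Metric.ball_subset_ball (min_le_left rx ry)) hX
  have hY' := smul_restrict_ball_mono (min_le_right cx cy)
    (Metric.ball_subset_ball (min_le_right rx ry)) hY
  -- Tolerance r/4: after Km steps the ball has radius Km r/2 and its centre is off by at most Km
  -- r/4, leaving radius Km r/4 around the mean.
  obtain ⟨i, j, hij, hcomb⟩ := exists_nat_combination (x := 2 * x) (y := 2 * y) (r := r / 4)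
    (by linarith) (by linarith) (by positivity)
  set D := c * ENNReal.ofReal (min 1 (r / 2)) with hD
  have hD0 : D ≠ 0 := by
    refine mul_ne_zero hc0 ?_
    simp [hr0]
  set K := i + j with hK
  set d := (min D 1).toReal with hd
  have hdt : min D 1 ≠ ∞ := ne_top_of_le_ne_top ENNReal.one_ne_top (min_le_right _ _)
  have hd0 : 0 < d := ENNReal.toReal_pos (by simp [hD0]) hdt
  have hd1 : d ≤ 1 := by
    simpa using ENNReal.toReal_mono ENNReal.one_ne_top (min_le_right D 1)
  refine ⟨2 * K, by omega, d ^ K, by positivity, pow_le_one₀ hd0.le hd1, K * (r / 4), by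
    have : (0 : ℝ) < K := by exact_mod_cast hij
    positivity, fun m hm => ?_⟩
  have hKm : 0 < K * m := Nat.mul_pos hij hm
  have h := smul_restrict_ball_le_convPow hr0 hX' hY' (K * m - 1) (i * m) (j * m)
    (by rw [Nat.sub_add_cancel hKm, hK, add_mul])
  rw [Nat.sub_add_cancel hKm] at h
  rw [mul_assoc]
  refine smul_restrict_ball_mono ?_ ?_ h
  · rw [← pow_mul, ENNReal.ofReal_pow hd0.le, hd, ENNReal.ofReal_toReal hdt]
    gcongr
    exact min_le_left _ _
  · refine Metric.ball_subset_ball' ?_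
    rw [Real.dist_eq, abs_sub_comm]
    have hm0 : (0 : ℝ) < m := by exact_mod_cast hm
    have e : ((i * m : ℕ) : ℝ) * (2 * x) + ((j * m : ℕ) : ℝ) * (2 * y) - ((2 * (K * m) : ℕ) : ℝ) =
        m * (i * (2 * x) + j * (2 * y) - 2 * (i + j)) := by
      rw [hK]; push_cast; ring
    rw [e, abs_mul, abs_of_pos hm0]
    have := mul_le_mul_of_nonneg_left hcomb hm0.le
    rw [hK] at *
    push_cast at *
    nlinarith

instance isProbabilityMeasure_convPow [IsProbabilityMeasure ρ] (n : ℕ) :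
    IsProbabilityMeasure (convPow ρ n) := ⟨by rw [convPow_univ]; simp⟩

lemma moments_convPow [IsProbabilityMeasure ρ] (h2 : MemLp id 2 ρ) (h1 : ∫ x, x ∂ρ = 1) (n : ℕ) :
    MemLp id 2 (convPow ρ n) ∧ ∫ x, x ∂convPow ρ n = n ∧
      Var[id; convPow ρ n] = n * Var[id; ρ] := by
  induction n with
  | zero =>
    refine ⟨?_, ?_, ?_⟩
    · refine MemLp.ae_eq (f := fun _ => (0 : ℝ)) ?_ (memLp_const _)
      simp [convPow, EventuallyEq, ae_dirac_eq]
    · simp [convPow]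
    · simp [convPow]
  | succ n ih =>
    obtain ⟨ih1, ih2, ih3⟩ := ih
    have hm : Measurable fun p : ℝ × ℝ => p.1 + p.2 := by fun_prop
    have hF := h2.comp_fst (convPow ρ n)
    have hS := ih1.comp_snd ρ
    have hL : MemLp (fun p : ℝ × ℝ => p.1 + p.2) 2 (ρ.prod (convPow ρ n)) := hF.add hS
    refine ⟨?_, ?_, ?_⟩
    · rw [convPow, Measure.conv, memLp_map_measure_iff aestronglyMeasurable_id hm.aemeasurable]
      exact hL
    · rw [convPow, Measure.conv, integral_map (f := fun x : ℝ => x) hm.aemeasurable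
        aestronglyMeasurable_id, integral_add (f := fun p : ℝ × ℝ => p.1) (g := fun p : ℝ × ℝ => p.2)
        (hF.integrable one_le_two) (hS.integrable one_le_two),
        integral_fun_fst (fun x : ℝ => x), integral_fun_snd (fun x : ℝ => x), ih2]
      simp [h1, add_comm]
    · rw [convPow, Measure.conv, variance_id_map hm.aemeasurable]
      have := variance_add_prod h2 ih1
      rw [ih3] at this
      simp only [id] at this
      rw [this]
      push_cast
      ring

end ConvPow

/-! ### Subexponential lower bound for the sliced partition function -/

lemma le_convPow_of_variance {ρ : Measure ℝ} [IsProbabilityMeasure ρ] (h2 : MemLp id 2 ρ)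
    (h1 : ∫ x, x ∂ρ = 1) {n : ℕ} {c : ℝ} (hc : 0 < c) (h : 2 * (n * Var[id; ρ]) ≤ c ^ 2) :
    2⁻¹ ≤ convPow ρ n (Metric.ball (n : ℝ) c) := by
  obtain ⟨hm, hmean, hvar⟩ := moments_convPow h2 h1 n
  have hch := meas_ge_le_variance_div_sq hm hc
  have hset : {ω : ℝ | c ≤ |id ω - ∫ x, id x ∂convPow ρ n|} = (Metric.ball (n : ℝ) c)ᶜ := by
    ext ω
    have : ∫ x, id x ∂convPow ρ n = n := hmean
    rw [this]
    simp [Real.dist_eq]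
  rw [hset, hvar] at hch
  have hle : convPow ρ n (Metric.ball (n : ℝ) c)ᶜ ≤ 2⁻¹ := by
    refine hch.trans ?_
    have e : (2⁻¹ : ℝ≥0∞) = ENNReal.ofReal (2⁻¹) := by
      rw [ENNReal.ofReal_inv_of_pos (by norm_num)]; simp
    rw [e]
    refine ENNReal.ofReal_le_ofReal ?_
    rw [div_le_iff₀ (by positivity)]
    linarith
  rw [prob_compl_eq_one_sub measurableSet_ball, tsub_le_iff_right] at hle
  have h12 : (1 : ℝ≥0∞) = 2⁻¹ + 2⁻¹ := ENNReal.inv_two_add_inv_two.symm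
  rw [h12] at hle
  exact (ENNReal.add_le_add_iff_left (by simp)).1 hle

/-- Among n = p + km summands, Chebyshev keeps the first p within mη/2 of their mean p with
probability at least 1/2. The condition on R then places every target in the ball of radius R within
reach of the last km summands, whose density there is at least d^m. -/
lemma le_slicedZ (hg : Measurable g) [IsProbabilityMeasure (sqLaw g)]
    (h2 : MemLp id 2 (sqLaw g)) (h1 : ∫ x, x ∂sqLaw g = 1) {k : ℕ} {d η R : ℝ}
    {m : ℕ} (hfloor : ENNReal.ofReal (d ^ m) •
      volume.restrict (Metric.ball ((k * m : ℕ) : ℝ) (m * η)) ≤ convPow (sqLaw g) (k * m))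
    (hR : 0 ≤ R) (hmR : R + 2 ≤ m * (η / 2)) {n : ℕ} (hkm : k * m ≤ n)
    (hvar : 2 * (n * Var[id; sqLaw g]) ≤ (m * (η / 2)) ^ 2) :
    ENNReal.ofReal (d ^ m) * (∫⁻ z in Metric.ball 0 R, circ g z) * 2⁻¹ ≤ slicedZ g n := by
  obtain ⟨p, rfl⟩ := Nat.exists_eq_add_of_le' hkm
  set B := Metric.ball (p : ℝ) (m * (η / 2)) with hB
  have hcm : Measurable (circ g) := measurable_circ hg
  have hpB : 2⁻¹ ≤ convPow (sqLaw g) p B := by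
    refine le_convPow_of_variance h2 h1 (by linarith) (le_trans ?_ hvar)
    have := variance_nonneg id (sqLaw g)
    gcongr
    simp
  have hinner : ∀ s ∈ B, ENNReal.ofReal (d ^ m) * (∫⁻ z in Metric.ball 0 R, circ g z) ≤
      ∫⁻ y, circ g (((p + k * m + 2 : ℕ) : ℝ) - (s + y)) ∂convPow (sqLaw g) (k * m) := by
    intro s hs
    refine le_trans ?_ (lintegral_mono' hfloor le_rfl)
    rw [lintegral_smul_measure, smul_eq_mul]
    refine mul_le_mul' le_rfl ?_
    have hmp := Measure.measurePreserving_sub_left (volume : Measure ℝ)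
      (((p + k * m + 2 : ℕ) : ℝ) - s)
    rw [← lintegral_indicator measurableSet_ball, ← lintegral_indicator measurableSet_ball,
      ← hmp.lintegral_comp (hcm.indicator measurableSet_ball)]
    refine lintegral_mono fun y => ?_
    simp only [indicator]
    split_ifs with hy hy'
    · rw [sub_sub]
    · refine absurd ?_ hy'
      rw [Metric.mem_ball, Real.dist_eq, abs_lt] at hs hy ⊢
      push_cast at hs hy ⊢
      constructor <;> linarith [hs.1, hs.2, hy.1, hy.2]
    · exact zero_le
    · exact zero_le
  rw [slicedZ, convPow_add, Measure.lintegral_conv (by fun_prop)]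
  calc ENNReal.ofReal (d ^ m) * (∫⁻ z in Metric.ball 0 R, circ g z) * 2⁻¹
      ≤ ENNReal.ofReal (d ^ m) * (∫⁻ z in Metric.ball 0 R, circ g z) * convPow (sqLaw g) p B := by
        gcongr
    _ = ∫⁻ s in B, ENNReal.ofReal (d ^ m) * (∫⁻ z in Metric.ball 0 R, circ g z)
          ∂convPow (sqLaw g) p := by rw [setLIntegral_const]
    _ ≤ ∫⁻ s in B, ∫⁻ y, circ g (((p + k * m + 2 : ℕ) : ℝ) - (s + y)) ∂convPow (sqLaw g) (k * m)
          ∂convPow (sqLaw g) p := by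
        refine setLIntegral_mono' measurableSet_ball hinner
    _ ≤ _ := setLIntegral_le_lintegral _ _

/-- Otherwise the probability measure ρ ∗ ρ, whose density is half of `circ g`, would vanish on all
balls. -/
lemma exists_setLIntegral_circ_ne_zero (hg : Measurable g) [IsProbabilityMeasure (sqLaw g)] :
    ∃ R : ℝ, 0 ≤ R ∧ ∫⁻ z in Metric.ball 0 R, circ g z ≠ 0 := by
  by_contra! h
  have hcm : Measurable (circ g) := measurable_circ hg
  have hb : ∀ n : ℕ, (sqLaw g ∗ sqLaw g) (Metric.ball 0 (n : ℝ)) = 0 := fun n => by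
    rw [sqLaw_conv_sqLaw hg, withDensity_apply _ measurableSet_ball,
      lintegral_const_mul _ hcm, h n (Nat.cast_nonneg n), mul_zero]
  have hu := measure_iUnion_null hb
  rw [Metric.iUnion_ball_nat] at hu
  simp at hu

/-- Subexponential lower bound for the sliced partition function. -/
lemma eventually_le_slicedZ (hg : Measurable g) [IsProbabilityMeasure (sqLaw g)]
    (h2 : MemLp id 2 (sqLaw g)) (h1 : ∫ x, x ∂sqLaw g = 1) {ε : ℝ} (hε : 0 < ε) :
    ∀ᶠ n : ℕ in atTop, ENNReal.ofReal (exp (-ε * n)) ≤ slicedZ g n := by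
  obtain ⟨k, hk, d, hd0, hd1, η, hη, hfloor⟩ := exists_smul_restrict_ball_le_convPow
    sqLaw_absolutelyContinuous (h2.integrable one_le_two) h1
  obtain ⟨R, hR, hq⟩ := exists_setLIntegral_circ_ne_zero hg
  set q := min 1 (∫⁻ z in Metric.ball 0 R, circ g z) with hqdef
  have hqt : q ≠ ∞ := ne_top_of_le_ne_top ENNReal.one_ne_top (min_le_left _ _)
  have hq0 : 0 < q.toReal := ENNReal.toReal_pos (by
    rw [hqdef, ← pos_iff_ne_zero]; exact lt_min one_pos (pos_iff_ne_zero.2 hq)) hqt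
  -- The first bound gives km ≤ n, the second d^m ≥ exp(-εn/2) for m = ⌊δn⌋. The 1 in the
  -- denominator covers d = 1.
  set δ : ℝ := min (1 / k) (ε / 2 / (1 - log d)) with hδ
  have hlog : 0 ≤ -log d := by linarith [Real.log_nonpos hd0.le hd1]
  have hk0 : (0 : ℝ) < k := by exact_mod_cast hk
  have hδ0 : 0 < δ := lt_min (by positivity) (div_pos (by positivity) (by linarith))
  have hfl : Tendsto (fun n : ℕ => (⌊δ * n⌋₊ : ℝ)) atTop atTop :=
    tendsto_natCast_atTop_atTop.comp
      (tendsto_nat_floor_atTop.comp (tendsto_natCast_atTop_atTop.const_mul_atTop hδ0))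
  have hn : Tendsto (fun n : ℕ => (n : ℝ)) atTop atTop := tendsto_natCast_atTop_atTop
  set V := Var[id; sqLaw g] with hV
  have hV0 : 0 ≤ V := variance_nonneg _ _
  -- In order: m ≥ 1 gives m ≥ δn/2; room for R + 2; the Chebyshev condition, as the variance is
  -- linear in n and the window quadratic; and absorption of the constant q/2 into exp(-εn/2).
  filter_upwards [hfl.eventually_ge_atTop 1, hfl.eventually_ge_atTop ((R + 2) / (η / 2)),
    hn.eventually_ge_atTop (8 * V * 4 / (δ ^ 2 * η ^ 2)),
    hn.eventually_ge_atTop ((log 2 - log q.toReal) / (ε / 2)), hn.eventually_gt_atTop 0]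
    with n hm1 hmR hnV hnq hn0
  set m := ⌊δ * n⌋₊ with hm
  have hm0 : 0 < m := by
    have : (0 : ℝ) < m := by linarith
    exact_mod_cast this
  have hmle : (m : ℝ) ≤ δ * n := Nat.floor_le (by positivity)
  have hmlt : δ * n < m + 1 := Nat.lt_floor_add_one _
  have hm2 : δ * n / 2 ≤ m := by linarith
  have hδk : δ * k ≤ 1 := by
    have := min_le_left (1 / (k : ℝ)) (ε / 2 / (1 - log d))
    rw [← hδ, le_div_iff₀ hk0] at this
    exact this
  have hδd : δ * (1 - log d) ≤ ε / 2 := by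
    have := min_le_right (1 / (k : ℝ)) (ε / 2 / (1 - log d))
    rwa [← hδ, le_div_iff₀ (by linarith)] at this
  have hkm : k * m ≤ n := by
    have : (k : ℝ) * m ≤ n := by
      calc (k : ℝ) * m ≤ k * (δ * n) := by gcongr
        _ = (δ * k) * n := by ring
        _ ≤ 1 * n := by gcongr
        _ = n := one_mul _
    exact_mod_cast this
  have hvar : 2 * (n * V) ≤ (m * (η / 2)) ^ 2 := by
    rw [div_le_iff₀ (by positivity)] at hnV
    calc 2 * (n * V) = (8 * V * 4) * n / 16 := by ring
      _ ≤ (n * (δ ^ 2 * η ^ 2)) * n / 16 := by gcongr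
      _ = (δ * n / 2 * (η / 2)) ^ 2 := by ring
      _ ≤ _ := by gcongr
  rw [div_le_iff₀ (by positivity)] at hmR
  refine le_trans ?_ (le_slicedZ hg h2 h1 (hfloor m hm0) hR hmR hkm hvar)
  calc ENNReal.ofReal (exp (-ε * n)) ≤ ENNReal.ofReal (d ^ m * q.toReal * 2⁻¹) := by
        refine ENNReal.ofReal_le_ofReal ?_
        rw [← Real.le_log_iff_exp_le (by positivity), Real.log_mul (by positivity) (by norm_num),
          Real.log_mul (by positivity) hq0.ne', Real.log_pow, Real.log_inv]
        rw [div_le_iff₀ (by positivity)] at hnq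
        have h3 : (m : ℝ) * (-log d) ≤ δ * n * (-log d) := by gcongr
        have h4 : δ * (1 - log d) * n ≤ ε / 2 * n := by gcongr
        nlinarith
    _ = ENNReal.ofReal (d ^ m) * q * 2⁻¹ := by
        rw [ENNReal.ofReal_mul (by positivity), ENNReal.ofReal_mul (by positivity),
          ENNReal.ofReal_toReal hqt, ENNReal.ofReal_inv_of_pos (by norm_num)]
        simp
    _ ≤ _ := by
        gcongr
        exact min_le_right _ _

/-! ### Kac densities and the exponential rate of the partition function -/

/-- Probability densities on the line with unit second moment, finite fourth moment and an
essential upper bound. -/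
structure IsKacDensity (f : ℝ → ℝ) : Prop where
  measurable : Measurable f
  nonneg : ∀ v, 0 ≤ f v
  mass : ∫ v, f v = 1
  second : ∫ v, f v * v ^ 2 = 1
  fourth : Integrable fun v => f v * v ^ 4
  bounded : ∃ C : ℝ, 1 ≤ C ∧ ∀ᵐ v, f v ≤ C

lemma slicedZ_ofReal_le {g : ℝ → ℝ} (hg : Measurable g) (hg0 : ∀ v, 0 ≤ g v) (hgi : Integrable g)
    {C : ℝ} (hC : ∀ᵐ v, g v ≤ C) (hC0 : 0 ≤ C) {n : ℕ} (hn : n ≠ 0) :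
    slicedZ (fun v => ENNReal.ofReal (g v)) n ≤
      ENNReal.ofReal (2 * π * C ^ 2 * (∫ v, g v) ^ n) := by
  refine (slicedZ_le (C := ENNReal.ofReal C) (by fun_prop) ?_ hn).trans_eq ?_
  · filter_upwards [hC] with v hv using ENNReal.ofReal_le_ofReal hv
  · rw [← ofReal_integral_eq_lintegral_ofReal hgi (ae_of_all _ hg0),
      ← ENNReal.ofReal_pow hC0, ← ENNReal.ofReal_pow (integral_nonneg hg0),
      ← ENNReal.ofReal_mul (by positivity), ← ENNReal.ofReal_mul (by positivity)]

/-- The logarithm of the sliced partition function. -/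
def logSliced (f : ℝ → ℝ) (n : ℕ) : ℝ :=
  log (slicedZ (fun v => ENNReal.ofReal (f v)) n).toReal

lemma integral_densityMeasure {f : ℝ → ℝ} (hf : Measurable f) (hf0 : ∀ v, 0 ≤ f v) (φ : ℝ → ℝ) :
    ∫ x, φ x ∂densityMeasure f = ∫ x, f x * φ x := by
  rw [densityMeasure, integral_withDensity_eq_integral_toReal_smul (by fun_prop)
    (ae_of_all _ fun _ => ENNReal.ofReal_lt_top)]
  simp [ENNReal.toReal_ofReal (hf0 _)]

lemma integrable_densityMeasure_iff {f : ℝ → ℝ} (hf : Measurable f) (hf0 : ∀ v, 0 ≤ f v)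
    {φ : ℝ → ℝ} : Integrable φ (densityMeasure f) ↔ Integrable fun x => f x * φ x := by
  rw [densityMeasure, integrable_withDensity_iff_integrable_smul' (by fun_prop)
    (ae_of_all _ fun _ => ENNReal.ofReal_lt_top)]
  simp [ENNReal.toReal_ofReal (hf0 _)]

namespace IsKacDensity

variable {f : ℝ → ℝ}

lemma integrable (hf : IsKacDensity f) : Integrable f := .of_integral_ne_zero (by simp [hf.mass])

lemma integrable_second (hf : IsKacDensity f) : Integrable fun v => f v * v ^ 2 :=
  .of_integral_ne_zero (by simp [hf.second])

lemma isProbabilityMeasure_densityMeasure (hf : IsKacDensity f) :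
    IsProbabilityMeasure (densityMeasure f) := by
  constructor
  rw [densityMeasure, withDensity_apply _ .univ, setLIntegral_univ,
    ← ofReal_integral_eq_lintegral_ofReal hf.integrable (ae_of_all _ hf.nonneg), hf.mass,
    ENNReal.ofReal_one]

lemma isProbabilityMeasure_sqLaw (hf : IsKacDensity f) :
    IsProbabilityMeasure (sqLaw fun v => ENNReal.ofReal (f v)) :=
  have := hf.isProbabilityMeasure_densityMeasure
  Measure.isProbabilityMeasure_map (μ := densityMeasure f) (by fun_prop)

lemma memLp_sqLaw (hf : IsKacDensity f) : MemLp id 2 (sqLaw fun v => ENNReal.ofReal (f v)) := by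
  refine (memLp_two_iff_integrable_sq aestronglyMeasurable_id).2 ?_
  refine (integrable_map_measure (μ := densityMeasure f) (by fun_prop) (by fun_prop)).2 ?_
  rw [integrable_densityMeasure_iff hf.measurable hf.nonneg]
  refine hf.fourth.congr (ae_of_all _ fun x => ?_)
  simp only [Function.comp, id]
  ring

lemma integral_sqLaw (hf : IsKacDensity f) :
    ∫ x, x ∂sqLaw (fun v => ENNReal.ofReal (f v)) = 1 := by
  have : ∫ x, x ∂(densityMeasure f).map (· ^ 2) = ∫ x, x ^ 2 ∂densityMeasure f :=
    integral_map (by fun_prop) aestronglyMeasurable_id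
  rw [sqLaw]
  refine this.trans ?_
  rw [integral_densityMeasure hf.measurable hf.nonneg, hf.second]

lemma slicedZ_ne_top (hf : IsKacDensity f) {n : ℕ} (hn : n ≠ 0) :
    slicedZ (fun v => ENNReal.ofReal (f v)) n ≠ ∞ := by
  obtain ⟨C, hC1, hC⟩ := hf.bounded
  exact ne_top_of_le_ne_top ENNReal.ofReal_ne_top
    (slicedZ_ofReal_le hf.measurable hf.nonneg hf.integrable hC (by linarith) hn)

lemma eventually_slicedZ_ne_zero (hf : IsKacDensity f) :
    ∀ᶠ n : ℕ in atTop, slicedZ (fun v => ENNReal.ofReal (f v)) n ≠ 0 := by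
  have := hf.isProbabilityMeasure_sqLaw
  have hm := hf.measurable
  filter_upwards [eventually_le_slicedZ (by fun_prop) hf.memLp_sqLaw hf.integral_sqLaw one_pos]
    with n hn h
  rw [h] at hn
  rw [nonpos_iff_eq_zero, ENNReal.ofReal_eq_zero] at hn
  exact absurd hn (not_le.2 (Real.exp_pos _))

lemma tendsto_logSliced (hf : IsKacDensity f) :
    Tendsto (fun n : ℕ => logSliced f n / n) atTop (𝓝 0) := by
  obtain ⟨C, hC1, hC⟩ := hf.bounded
  have := hf.isProbabilityMeasure_sqLaw
  have hm := hf.measurable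
  rw [tendsto_order]
  constructor
  · intro a ha
    filter_upwards [eventually_le_slicedZ (by fun_prop) hf.memLp_sqLaw hf.integral_sqLaw
      (show 0 < -a / 2 by linarith), eventually_gt_atTop 0] with n hn hn0
    have hn0' : (0 : ℝ) < n := by exact_mod_cast hn0
    rw [lt_div_iff₀ hn0']
    have h1 : exp (-(-a / 2) * n) ≤ (slicedZ (fun v => ENNReal.ofReal (f v)) n).toReal :=
      (ENNReal.ofReal_le_iff_le_toReal (hf.slicedZ_ne_top hn0.ne')).1 hn
    have h2 := Real.log_le_log (Real.exp_pos _) h1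
    rw [Real.log_exp] at h2
    unfold logSliced
    nlinarith
  · intro a ha
    have hlim : Tendsto (fun n : ℕ => log (2 * π * C ^ 2) / n) atTop (𝓝 0) :=
      tendsto_const_div_atTop_nhds_zero_nat _
    filter_upwards [hf.eventually_slicedZ_ne_zero, eventually_gt_atTop 0,
      hlim.eventually (gt_mem_nhds ha)] with n hz hn0 hn
    refine lt_of_le_of_lt ?_ hn
    have h1 := slicedZ_ofReal_le hf.measurable hf.nonneg hf.integrable hC (by linarith) hn0.ne'
    rw [hf.mass, one_pow, mul_one] at h1
    have h2 := ENNReal.toReal_le_of_le_ofReal (by positivity) h1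
    unfold logSliced
    gcongr
    exact ENNReal.toReal_pos hz (hf.slicedZ_ne_top hn0.ne')

end IsKacDensity

lemma isKacDensity_gaussianPDFReal : IsKacDensity (gaussianPDFReal 0 1) where
  measurable := measurable_gaussianPDFReal 0 1
  nonneg := gaussianPDFReal_nonneg 0 1
  mass := integral_gaussianPDFReal_eq_one 0 one_ne_zero
  second := by
    have h := variance_eq_sub (memLp_id_gaussianReal' (μ := 0) (v := 1) 2 (by simp))
    rw [variance_id_gaussianReal] at h
    simp only [Pi.pow_apply, id, integral_id_gaussianReal] at h
    rw [integral_gaussianReal_eq_integral_smul one_ne_zero] at h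
    simpa using h.symm
  fourth := by
    have h := integrable_pow_of_mem_interior_integrableExpSet (X := id) (μ := gaussianReal 0 1)
      (by simp) 4
    rw [gaussianReal_of_var_ne_zero 0 one_ne_zero] at h
    exact (integrable_densityMeasure_iff (measurable_gaussianPDFReal 0 1)
      (gaussianPDFReal_nonneg 0 1)).1 h
  bounded := by
    refine ⟨1, le_rfl, ae_of_all _ fun v => ?_⟩
    rw [gaussianPDFReal_def]
    refine mul_le_one₀ (inv_le_one_of_one_le₀ ?_) (Real.exp_pos _).le (Real.exp_le_one_iff.2 ?_)
    · rw [Real.one_le_sqrt]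
      simp only [NNReal.coe_one, mul_one]
      linarith [Real.pi_gt_three]
    · simp only [sub_zero, NNReal.coe_one, mul_one]
      have := sq_nonneg v
      linarith

lemma log_gaussianPDFReal (x : ℝ) :
    log (gaussianPDFReal 0 1 x) = -(log (2 * π) / 2) - x ^ 2 / 2 := by
  rw [gaussianPDFReal_def]
  simp only [sub_zero, NNReal.coe_one, mul_one]
  rw [Real.log_mul (by positivity) (Real.exp_pos _).ne', Real.log_exp, Real.log_inv,
    Real.log_sqrt (by positivity)]
  ring

lemma sum_sq_sphere {N : ℕ} (v : Sphere N) : ∑ j, (v : EuclideanSpace ℝ (Fin N)) j ^ 2 = N := by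
  have h : ‖(v : EuclideanSpace ℝ (Fin N))‖ = √N := by simp
  have h2 := EuclideanSpace.norm_sq_eq (v : EuclideanSpace ℝ (Fin N))
  rw [h, Real.sq_sqrt (Nat.cast_nonneg N)] at h2
  simpa using h2.symm

/-- The Gaussian product depends only on the sum of squares, which is fixed on the sphere. This
explicit value determines the dimensional constant to exponential order. -/
lemma Z_gaussian (n : ℕ) : Z (gaussianPDFReal 0 1) (n + 2) =
    ENNReal.ofReal (exp (-(((n + 2 : ℕ) : ℝ) * ((log (2 * π) + 1) / 2)))) := by
  have h : ∀ v, tensor (gaussianPDFReal 0 1) (n + 2) v =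
      ENNReal.ofReal (exp (-(((n + 2 : ℕ) : ℝ) * ((log (2 * π) + 1) / 2)))) := by
    intro v
    rw [tensor, ← ENNReal.ofReal_prod_of_nonneg fun i _ => gaussianPDFReal_nonneg 0 1 _]
    congr 1
    have hp : ∀ x, gaussianPDFReal 0 1 x = exp (-(log (2 * π) / 2) - x ^ 2 / 2) := fun x => by
      rw [← log_gaussianPDFReal, Real.exp_log (gaussianPDFReal_pos 0 1 x one_ne_zero)]
    simp_rw [hp]
    rw [← Real.exp_sum, Finset.sum_sub_distrib, ← Finset.sum_div, sum_sq_sphere]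
    simp only [Finset.sum_const, Finset.card_univ, Fintype.card_fin, nsmul_eq_mul]
    congr 1
    ring
  rw [Z]
  simp_rw [h]
  simp

/-- The exponential rate of the partition function of a Kac density is that of the Gaussian. -/
lemma IsKacDensity.tendsto_log_Z {f : ℝ → ℝ} (hf : IsKacDensity f) :
    Tendsto (fun n : ℕ => log (Z f (n + 2)).toReal / ((n + 2 : ℕ) : ℝ)) atTop
      (𝓝 (-((log (2 * π) + 1) / 2))) := by
  have hγ := isKacDensity_gaussianPDFReal
  have hrat : Tendsto (fun n : ℕ => (n : ℝ) / ((n + 2 : ℕ) : ℝ)) atTop (𝓝 1) := by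
    simpa using tendsto_natCast_div_add_atTop (2 : ℝ)
  have hlim := ((hf.tendsto_logSliced.sub hγ.tendsto_logSliced).mul hrat).sub
    (tendsto_const_nhds (x := (log (2 * π) + 1) / 2))
  simp only [sub_zero, zero_mul, zero_sub] at hlim
  refine hlim.congr' ?_
  filter_upwards [hf.eventually_slicedZ_ne_zero, hγ.eventually_slicedZ_ne_zero,
    eventually_gt_atTop 0] with n h1 h2 hn
  obtain ⟨κ, hκ0, hκt, hκ⟩ := exists_Z_eq_mul_slicedZ n
  have hpos : ∀ {g : ℝ → ℝ}, IsKacDensity g →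
      slicedZ (fun v => ENNReal.ofReal (g v)) n ≠ 0 →
      log (Z g (n + 2)).toReal = log κ.toReal + logSliced g n := by
    intro g hg hz
    rw [hκ g hg.measurable, ENNReal.toReal_mul, Real.log_mul
      (ENNReal.toReal_pos hκ0 hκt).ne' (ENNReal.toReal_pos hz (hg.slicedZ_ne_top hn.ne')).ne',
      logSliced]
  -- Both densities share the same κ, so the Gaussian identity eliminates it.
  have e1 := hpos hf h1
  have e2 := hpos hγ h2
  rw [Z_gaussian, ENNReal.toReal_ofReal (Real.exp_pos _).le, Real.log_exp] at e2
  have hn' : (n : ℝ) ≠ 0 := by exact_mod_cast hn.ne'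
  have hN : ((n + 2 : ℕ) : ℝ) ≠ 0 := by positivity
  rw [e1]
  field_simp
  linear_combination 2 * e2

/-! ### Entropy inequality and power tilts of the density -/

/-- The entropy inequality: exponential moments under `ν` control integrals under `μ`. -/
lemma exists_integrable_ge_of_lintegral_exp_le {α : Type*} [MeasurableSpace α] {μ ν : Measure α}
    [IsProbabilityMeasure μ] [SigmaFinite ν] (hμν : μ ≪ ν) (hint : Integrable (llr μ ν) μ)
    {Ψ : α → ℝ} (hΨ : Measurable Ψ) {b : ℝ}
    (hb : ∫⁻ x, ENNReal.ofReal (exp (Ψ x)) ∂ν ≤ ENNReal.ofReal (exp b)) :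
    ∃ U : α → ℝ, Integrable U μ ∧ (∀ x, Ψ x ≤ U x) ∧ ∫ x, U x ∂μ ≤ ∫ x, llr μ ν x ∂μ + b := by
  -- X has μ-mean at most 1, and 1 + z ≤ exp z gives Ψ ≤ llr + X + b - 1. This integrable majorant
  -- avoids assuming that Ψ is integrable.
  set X : α → ℝ := fun x => exp (Ψ x - b - llr μ ν x) with hX
  have hllr : Measurable (llr μ ν) := measurable_llr μ ν
  have hXm : Measurable X := by fun_prop
  have hX1 : ∫⁻ x, ENNReal.ofReal (X x) ∂μ ≤ 1 := by
    have hp : Measurable (μ.rnDeriv ν) := Measure.measurable_rnDeriv _ _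
    rw [← lintegral_rnDeriv_mul hμν (by fun_prop)]
    calc ∫⁻ x, μ.rnDeriv ν x * ENNReal.ofReal (X x) ∂ν
        ≤ ∫⁻ x, ENNReal.ofReal (exp (Ψ x)) * ENNReal.ofReal (exp (-b)) ∂ν := by
          -- Only an inequality: where dμ/dν vanishes the left side is 0, elsewhere the two sides
          -- agree.
          refine lintegral_mono_ae ?_
          filter_upwards [Measure.rnDeriv_lt_top μ ν] with x hx
          rcases eq_or_ne (μ.rnDeriv ν x) 0 with h0 | h0
          · simp [h0]
          · have hpos : 0 < (μ.rnDeriv ν x).toReal := ENNReal.toReal_pos h0 hx.ne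
            rw [← ENNReal.ofReal_mul (Real.exp_pos _).le, ← Real.exp_add]
            nth_rewrite 1 [← ENNReal.ofReal_toReal hx.ne]
            rw [← ENNReal.ofReal_mul hpos.le]
            refine ENNReal.ofReal_le_ofReal (le_of_eq ?_)
            rw [hX, llr_def]
            simp only
            nth_rewrite 1 [← Real.exp_log hpos]
            rw [← Real.exp_add]
            congr 1
            ring
      _ = (∫⁻ x, ENNReal.ofReal (exp (Ψ x)) ∂ν) * ENNReal.ofReal (exp (-b)) :=
          lintegral_mul_const _ (by fun_prop)
      _ ≤ ENNReal.ofReal (exp b) * ENNReal.ofReal (exp (-b)) := by gcongr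
      _ = 1 := by
          rw [← ENNReal.ofReal_mul (Real.exp_pos _).le, ← Real.exp_add]
          simp
  have hXi : Integrable X μ := by
    refine ⟨hXm.aestronglyMeasurable, ?_⟩
    rw [hasFiniteIntegral_iff_ofReal (ae_of_all _ fun x => (Real.exp_pos _).le)]
    exact hX1.trans_lt ENNReal.one_lt_top
  have hXle : ∫ x, X x ∂μ ≤ 1 := by
    rw [integral_eq_lintegral_of_nonneg_ae (ae_of_all _ fun x => (Real.exp_pos _).le)
      hXm.aestronglyMeasurable]
    exact ENNReal.toReal_le_of_le_ofReal zero_le_one (by simpa using hX1)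
  refine ⟨fun x => (llr μ ν x + X x) + (b - 1), (hint.add hXi).add (integrable_const _),
    fun x => ?_, ?_⟩
  · have := Real.add_one_le_exp (Ψ x - b - llr μ ν x)
    simp only [hX]
    linarith
  · rw [integral_add (f := fun x => llr μ ν x + X x) (hint.add hXi) (integrable_const _),
      integral_add hint hXi]
    simp only [integral_const, probReal_univ, smul_eq_mul, one_mul]
    linarith

/-- The density `f ^ (1 + t)`, written so that it vanishes where `f` does. -/
def powerTilt (f : ℝ → ℝ) (t : ℝ) (x : ℝ) : ℝ := f x * exp (t * log (f x))

namespace IsKacDensity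

variable {f : ℝ → ℝ}

lemma measurable_powerTilt (hf : IsKacDensity f) (t : ℝ) : Measurable (powerTilt f t) := by
  have := hf.measurable
  unfold powerTilt
  fun_prop

lemma powerTilt_nonneg (hf : IsKacDensity f) (t x : ℝ) : 0 ≤ powerTilt f t x :=
  mul_nonneg (hf.nonneg x) (Real.exp_pos _).le

end IsKacDensity

/-- For y ≤ 1 the exponent 1 + t ≥ 1/2 gives y^(1+t) ≤ √y; for y ≥ 1, y^t ≤ y ≤ C. The first bound
serves integrability of the tilt, the second its essential bound. -/
lemma mul_exp_mul_log_le {y t C : ℝ} (hy : 0 ≤ y) (hyC : y ≤ C) (hC : 1 ≤ C) (ht : |t| ≤ 1 / 2) :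
    y * exp (t * log y) ≤ √y + C * y ∧ y * exp (t * log y) ≤ C ^ 2 := by
  rw [abs_le] at ht
  have hexp : ∀ z : ℝ, 0 < z → exp (1 / 2 * log z) = √z := fun z hz => by
    rw [one_div, inv_mul_eq_div, ← Real.log_sqrt hz.le, Real.exp_log (Real.sqrt_pos.2 hz)]
  rcases hy.eq_or_lt with rfl | hy0
  · simp; positivity
  rcases le_total y 1 with h1 | h1
  · have hle : y * exp (t * log y) ≤ √y := by
      have hl := Real.log_nonpos hy h1
      have : exp (t * log y) ≤ (√y)⁻¹ := by
        rw [← hexp y hy0, ← Real.exp_neg]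
        exact Real.exp_le_exp.2 (by nlinarith)
      calc y * exp (t * log y) ≤ y * (√y)⁻¹ := by gcongr
        _ = √y := by rw [← div_eq_mul_inv, Real.div_sqrt]
    refine ⟨hle.trans (le_add_of_nonneg_right (by positivity)), hle.trans ?_⟩
    calc √y ≤ 1 := Real.sqrt_le_one.2 h1
      _ ≤ C ^ 2 := one_le_pow₀ hC
  · have hle : exp (t * log y) ≤ y := by
      have hl := Real.log_nonneg h1
      calc exp (t * log y) ≤ exp (log y) := Real.exp_le_exp.2 (by nlinarith)
        _ = y := Real.exp_log hy0
    constructor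
    · calc y * exp (t * log y) ≤ y * C := by gcongr; exact hle.trans hyC
        _ = C * y := mul_comm _ _
        _ ≤ _ := le_add_of_nonneg_left (Real.sqrt_nonneg y)
    · calc y * exp (t * log y) ≤ C * C := by gcongr; exact hle.trans hyC
        _ = C ^ 2 := by ring

namespace IsKacDensity

variable {f : ℝ → ℝ}

lemma integrable_sqrt (hf : IsKacDensity f) : Integrable fun x => √(f x) := by
  have hm := hf.measurable
  refine Integrable.mono' ((hf.integrable.add hf.integrable_second).add integrable_inv_one_add_sq)
    (by fun_prop) (ae_of_all _ fun x => ?_)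
  rw [Real.norm_of_nonneg (Real.sqrt_nonneg _)]
  simp only [Pi.add_apply]
  have hx : 0 < 1 + x ^ 2 := by positivity
  have h1 : √(f x) ^ 2 = f x := Real.sq_sqrt (hf.nonneg x)
  have h2 : (1 + x ^ 2)⁻¹ * (1 + x ^ 2) = 1 := inv_mul_cancel₀ hx.ne'
  -- With a = √f and w = 1 + x², the estimate a ≤ a²w + 1/w is aw ≤ (aw)² + 1; the second moment
  -- makes a²w integrable.
  have h3 := sq_nonneg (√(f x) * (1 + x ^ 2) - 1)
  have h4 : 0 ≤ √(f x) := Real.sqrt_nonneg _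
  have h5 : √(f x) * (1 + x ^ 2) ≤ (f x + f x * x ^ 2 + (1 + x ^ 2)⁻¹) * (1 + x ^ 2) := by
    have : (f x + f x * x ^ 2 + (1 + x ^ 2)⁻¹) * (1 + x ^ 2) =
        (√(f x) * (1 + x ^ 2)) ^ 2 + 1 := by
      rw [mul_pow, h1, add_mul, h2]; ring
    rw [this]
    nlinarith [mul_nonneg h4 hx.le]
  exact le_of_mul_le_mul_right h5 hx

lemma integrable_powerTilt (hf : IsKacDensity f) {t : ℝ} (ht : |t| ≤ 1 / 2) :
    Integrable (powerTilt f t) := by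
  obtain ⟨C, hC1, hC⟩ := hf.bounded
  refine Integrable.mono' (hf.integrable_sqrt.add (hf.integrable.const_mul C))
    (hf.measurable_powerTilt t).aestronglyMeasurable ?_
  filter_upwards [hC] with x hx
  rw [Real.norm_of_nonneg (hf.powerTilt_nonneg t x)]
  exact (mul_exp_mul_log_le (hf.nonneg x) hx hC1 ht).1

/-- The cumulant generating function of `log f` under `f dv`. -/
def logCgf (f : ℝ → ℝ) (t : ℝ) : ℝ := cgf (fun x => log (f x)) (densityMeasure f) t

lemma integral_powerTilt (hf : IsKacDensity f) {t : ℝ} (ht : |t| ≤ 1 / 2) :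
    ∫ x, powerTilt f t x = exp (logCgf f t) := by
  have := hf.isProbabilityMeasure_densityMeasure
  rw [logCgf, exp_cgf, mgf, integral_densityMeasure hf.measurable hf.nonneg]
  · rfl
  · exact (integrable_densityMeasure_iff hf.measurable hf.nonneg).2 (hf.integrable_powerTilt ht)

/-- The exponential moments of log f are the integrals of f^(1+t), finite for |t| ≤ 1/2. Hence Λ is
analytic at 0 and log f is integrable. -/
lemma zero_mem_interior_integrableExpSet (hf : IsKacDensity f) :
    0 ∈ interior (integrableExpSet (fun x => log (f x)) (densityMeasure f)) := by
  refine mem_interior.2 ⟨Ioo (-(1 / 2)) (1 / 2), fun t ht => ?_, isOpen_Ioo, by norm_num⟩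
  exact (integrable_densityMeasure_iff hf.measurable hf.nonneg).2
    (hf.integrable_powerTilt (abs_le.2 ⟨ht.1.le, ht.2.le⟩))

/-- The entropy integral `∫ f log f`. -/
def entropy (f : ℝ → ℝ) : ℝ := ∫ x, log (f x) ∂densityMeasure f

lemma hasDerivAt_logCgf (hf : IsKacDensity f) : HasDerivAt (logCgf f) (entropy f) 0 := by
  have := hf.isProbabilityMeasure_densityMeasure
  have h := hf.zero_mem_interior_integrableExpSet
  have hd := (analyticAt_cgf h).differentiableAt.hasDerivAt
  rw [deriv_cgf_zero h, probReal_univ, div_one] at hd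
  exact hd

lemma logCgf_zero (hf : IsKacDensity f) : logCgf f 0 = 0 := by
  have := hf.isProbabilityMeasure_densityMeasure
  simp [logCgf]

lemma tendsto_slope_logCgf (hf : IsKacDensity f) :
    Tendsto (fun t => logCgf f t / t) (𝓝[≠] 0) (𝓝 (entropy f)) := by
  have := hf.hasDerivAt_logCgf.tendsto_slope_zero
  refine this.congr fun t => ?_
  simp [hf.logCgf_zero, div_eq_inv_mul]

lemma integrable_log (hf : IsKacDensity f) :
    Integrable (fun x => log (f x)) (densityMeasure f) := by
  simpa using integrable_pow_of_mem_interior_integrableExpSet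
    hf.zero_mem_interior_integrableExpSet 1

/-- Relative entropy with respect to the standard Gaussian. -/
lemma klDiv_gaussianReal (hf : IsKacDensity f) :
    klDiv (densityMeasure f) (gaussianReal 0 1) =
      ENNReal.ofReal (entropy f + (log (2 * π) + 1) / 2) := by
  have := hf.isProbabilityMeasure_densityMeasure
  have hm := hf.measurable
  have hac : densityMeasure f ≪ gaussianReal 0 1 :=
    (withDensity_absolutelyContinuous _ _).trans (gaussianReal_absolutelyContinuous' 0 one_ne_zero)
  have hvol : densityMeasure f ≪ volume := withDensity_absolutelyContinuous _ _
  have hrn : ∀ᵐ x ∂densityMeasure f, llr (densityMeasure f) (gaussianReal 0 1) x =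
      log (f x) + (log (2 * π) / 2 + x ^ 2 / 2) := by
    have h1 := Measure.rnDeriv_mul_rnDeriv (κ := volume) hac
    have h2 : (densityMeasure f).rnDeriv volume =ᵐ[volume] fun v => ENNReal.ofReal (f v) :=
      Measure.rnDeriv_withDensity _ (by fun_prop)
    have h3 : (gaussianReal 0 1).rnDeriv volume =ᵐ[volume] gaussianPDF 0 1 :=
      rnDeriv_gaussianReal 0 1
    have hpos : ∀ᵐ x ∂densityMeasure f, 0 < f x := by
      rw [densityMeasure, ae_withDensity_iff (by fun_prop)]
      refine ae_of_all _ fun x hx => ?_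
      simpa using hx
    filter_upwards [hvol.ae_le h1, hvol.ae_le h2, hvol.ae_le h3, hpos] with x e1 e2 e3 e4
    rw [Pi.mul_apply, e2, e3] at e1
    have e5 := congrArg ENNReal.toReal e1
    rw [ENNReal.toReal_mul, ENNReal.toReal_ofReal e4.le, toReal_gaussianPDF] at e5
    have hg := gaussianPDFReal_pos 0 1 x one_ne_zero
    have hne : ((densityMeasure f).rnDeriv (gaussianReal 0 1) x).toReal ≠ 0 := by
      intro h0
      rw [h0, zero_mul] at e5
      exact e4.ne e5
    have e6 := congrArg log e5
    rw [Real.log_mul hne hg.ne', log_gaussianPDFReal] at e6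
    rw [llr_def]
    simp only
    linarith
  have hsq : Integrable (fun x : ℝ => x ^ 2) (densityMeasure f) :=
    (integrable_densityMeasure_iff hm hf.nonneg).2 hf.integrable_second
  have hi2 : Integrable (fun x : ℝ => log (2 * π) / 2 + x ^ 2 / 2) (densityMeasure f) :=
    (integrable_const _).add (hsq.div_const 2)
  have hi : Integrable (fun x => log (f x) + (log (2 * π) / 2 + x ^ 2 / 2)) (densityMeasure f) :=
    hf.integrable_log.add hi2
  have hint := (integrable_congr hrn).2 hi
  rw [klDiv_of_ac_of_integrable hac hint, integral_congr_ae hrn,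
    integral_add hf.integrable_log hi2, integral_add (integrable_const _) (hsq.div_const 2),
    integral_div 2 fun x : ℝ => x ^ 2, integral_densityMeasure hm hf.nonneg (fun x => x ^ 2), hf.second]
  congr 1
  simp only [integral_const, probReal_univ, smul_eq_mul, entropy]
  ring

end IsKacDensity

/-! ### Relative entropy and the mean of log f on the sphere -/

/-- The additive observable `∑ⱼ log f(vⱼ)`. -/
def logTensor (f : ℝ → ℝ) (N : ℕ) (v : Sphere N) : ℝ :=
  ∑ j, log (f ((v : EuclideanSpace ℝ (Fin N)) j))

namespace IsKacDensity

variable {f : ℝ → ℝ}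

lemma measurable_logTensor (hf : IsKacDensity f) (N : ℕ) : Measurable (logTensor f N) := by
  have : Measurable fun v : Sphere N => (v : EuclideanSpace ℝ (Fin N)).ofLp :=
    (PiLp.volume_preserving_ofLp _).measurable.comp measurable_subtype_coe
  have hm := hf.measurable
  unfold logTensor
  fun_prop

lemma tensor_mul_exp (hf : IsKacDensity f) (t : ℝ) (N : ℕ) (v : Sphere N) :
    tensor f N v * ENNReal.ofReal (exp (t * logTensor f N v)) = tensor (powerTilt f t) N v := by
  unfold tensor logTensor powerTilt
  rw [Finset.mul_sum, Real.exp_sum, ENNReal.ofReal_prod_of_nonneg fun _ _ => (Real.exp_pos _).le,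
    ← Finset.prod_mul_distrib]
  exact Finset.prod_congr rfl fun j _ => (ENNReal.ofReal_mul (hf.nonneg _)).symm

/-- Exponential tilting by an additive observable preserves the product form, so the moment is a
ratio of partition functions. -/
lemma lintegral_exp_conditioned (hf : IsKacDensity f) (t : ℝ) (N : ℕ) :
    ∫⁻ v, ENNReal.ofReal (exp (t * logTensor f N v)) ∂conditioned f N =
      Z (powerTilt f t) N / Z f N := by
  have hm := hf.measurable_logTensor N
  have ht := measurable_tensor hf.measurable N
  rw [conditioned, lintegral_withDensity_eq_lintegral_mul _ (by fun_prop) (by fun_prop),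
    Z.eq_def (powerTilt f t), ENNReal.div_eq_inv_mul, ← lintegral_const_mul _
      (measurable_tensor (hf.measurable_powerTilt t) N)]
  refine lintegral_congr fun v => ?_
  rw [← hf.tensor_mul_exp, Pi.mul_apply, ENNReal.div_eq_inv_mul, mul_assoc]

lemma isProbabilityMeasure_conditioned (hf : IsKacDensity f) {N : ℕ} (h0 : Z f N ≠ 0)
    (ht : Z f N ≠ ∞) : IsProbabilityMeasure (conditioned f N) := by
  constructor
  rw [conditioned, withDensity_apply _ .univ, setLIntegral_univ]
  simp_rw [div_eq_mul_inv]
  rw [lintegral_mul_const _ (measurable_tensor hf.measurable N)]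
  exact ENNReal.mul_inv_cancel h0 ht

lemma Z_ne_top (hf : IsKacDensity f) {n : ℕ} (hn : n ≠ 0) : Z f (n + 2) ≠ ∞ := by
  obtain ⟨κ, -, hκt, hκ⟩ := exists_Z_eq_mul_slicedZ n
  rw [hκ f hf.measurable]
  exact ENNReal.mul_ne_top hκt (hf.slicedZ_ne_top hn)

lemma Z_ne_zero (hf : IsKacDensity f) {n : ℕ}
    (hn : slicedZ (fun v => ENNReal.ofReal (f v)) n ≠ 0) : Z f (n + 2) ≠ 0 := by
  obtain ⟨κ, hκ0, -, hκ⟩ := exists_Z_eq_mul_slicedZ n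
  rw [hκ f hf.measurable]
  exact mul_ne_zero hκ0 hn

/-- Exponential moments of `logTensor` under the conditioned tensor product. -/
lemma exists_lintegral_exp_conditioned_le (hf : IsKacDensity f) :
    ∃ c : ℝ, ∀ t : ℝ, |t| ≤ 1 / 2 → ∀ n : ℕ, n ≠ 0 →
      slicedZ (fun v => ENNReal.ofReal (f v)) n ≠ 0 →
      ∫⁻ v, ENNReal.ofReal (exp (t * logTensor f (n + 2) v)) ∂conditioned f (n + 2) ≤
        ENNReal.ofReal (exp (c + n * logCgf f t - logSliced f n)) := by
  obtain ⟨C, hC1, hC⟩ := hf.bounded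
  -- C² bounds the tilt uniformly in |t| ≤ 1/2, so c depends on neither t nor n.
  refine ⟨log (2 * π * (C ^ 2) ^ 2), fun t ht n hn hz => ?_⟩
  obtain ⟨κ, hκ0, hκt, hκ⟩ := exists_Z_eq_mul_slicedZ n
  rw [hf.lintegral_exp_conditioned, hκ f hf.measurable, hκ _ (hf.measurable_powerTilt t),
    ENNReal.mul_div_mul_left _ _ hκ0 hκt]
  have hs : slicedZ (fun v => ENNReal.ofReal (f v)) n = ENNReal.ofReal (exp (logSliced f n)) := by
    rw [logSliced, Real.exp_log (ENNReal.toReal_pos hz (hf.slicedZ_ne_top hn)),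
      ENNReal.ofReal_toReal (hf.slicedZ_ne_top hn)]
  have hu := slicedZ_ofReal_le (hf.measurable_powerTilt t) (hf.powerTilt_nonneg t)
    (hf.integrable_powerTilt ht) (C := C ^ 2) (by
      filter_upwards [hC] with x hx
      exact (mul_exp_mul_log_le (hf.nonneg x) hx hC1 ht).2) (by positivity) hn
  rw [hf.integral_powerTilt ht] at hu
  rw [hs, Real.exp_sub, ENNReal.ofReal_div_of_pos (Real.exp_pos _), Real.exp_add,
    Real.exp_log (by positivity), mul_comm (n : ℝ), mul_comm (logCgf f t), Real.exp_nat_mul]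
  gcongr

/-- Splitting of the relative entropy with respect to the uniform measure. -/
lemma klDiv_sigma_eq (hf : IsKacDensity f) {n : ℕ} (h0 : Z f (n + 2) ≠ 0) (ht : Z f (n + 2) ≠ ∞)
    {μ : Measure (Sphere (n + 2))} [IsProbabilityMeasure μ]
    (hkl : klDiv μ (conditioned f (n + 2)) ≠ ∞) (hΦ : Integrable (logTensor f (n + 2)) μ) :
    klDiv μ (sigma (n + 2)) = ENNReal.ofReal ((klDiv μ (conditioned f (n + 2))).toReal +
      ∫ v, logTensor f (n + 2) v ∂μ - log (Z f (n + 2)).toReal) := by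
  have := hf.isProbabilityMeasure_conditioned h0 ht
  obtain ⟨hac, hint⟩ := klDiv_ne_top_iff.1 hkl
  have hσ : IsProbabilityMeasure (sigma (n + 2)) := isProbabilityMeasure_sigma (n + 1)
  have hd : μ.HaveLebesgueDecomposition (sigma (n + 2)) :=
    Measure.haveLebesgueDecomposition_of_sigmaFinite _ _
  have hcσ : conditioned f (n + 2) ≪ sigma (n + 2) := withDensity_absolutelyContinuous _ _
  have hacσ : μ ≪ sigma (n + 2) := hac.trans hcσ
  have hm := measurable_tensor hf.measurable (n + 2)
  have hrn : ∀ᵐ v ∂μ, llr μ (sigma (n + 2)) v = llr μ (conditioned f (n + 2)) v +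
      (logTensor f (n + 2) v - log (Z f (n + 2)).toReal) := by
    have h1 := Measure.rnDeriv_mul_rnDeriv (κ := sigma (n + 2)) hac
    have h2 : (conditioned f (n + 2)).rnDeriv (sigma (n + 2)) =ᵐ[sigma (n + 2)]
        fun v => tensor f (n + 2) v / Z f (n + 2) :=
      Measure.rnDeriv_withDensity _ (by fun_prop)
    -- The logarithm of the product splits only if no factor is 0; positivity of dμ/dσ μ-almost
    -- everywhere ensures this even where f has zeros.
    filter_upwards [hacσ.ae_le h1, hacσ.ae_le h2, Measure.rnDeriv_pos hacσ,
      hacσ.ae_le (Measure.rnDeriv_lt_top μ (sigma (n + 2)))] with v e1 e2 e3 e4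
    rw [Pi.mul_apply, e2] at e1
    have e5 := congrArg ENNReal.toReal e1
    have hpos := ENNReal.toReal_pos e3.ne' e4.ne
    rw [← e5, ENNReal.toReal_mul] at hpos
    have hA := left_ne_zero_of_mul hpos.ne'
    have hB := right_ne_zero_of_mul hpos.ne'
    rw [ENNReal.toReal_mul, ENNReal.toReal_div] at e5
    rw [ENNReal.toReal_div] at hB
    have hT : (tensor f (n + 2) v).toReal =
        ∏ j, f ((v : EuclideanSpace ℝ (Fin (n + 2))) j) := by
      rw [tensor, ENNReal.toReal_prod]
      exact Finset.prod_congr rfl fun j _ => ENNReal.toReal_ofReal (hf.nonneg _)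
    have hT0 : (tensor f (n + 2) v).toReal ≠ 0 := fun h => hB (by rw [h, zero_div])
    have hlogT : log (tensor f (n + 2) v).toReal = logTensor f (n + 2) v := by
      rw [hT] at hT0 ⊢
      rw [logTensor, Real.log_prod fun j hj => Finset.prod_ne_zero_iff.1 hT0 j hj]
    rw [llr_def, llr_def]
    simp only
    rw [← e5, Real.log_mul hA hB, Real.log_div hT0 (ENNReal.toReal_pos h0 ht).ne', hlogT]
  have hi2 : Integrable (fun v => logTensor f (n + 2) v - log (Z f (n + 2)).toReal) μ :=
    hΦ.sub (integrable_const _)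
  have hintσ := (integrable_congr hrn).2 (hint.add hi2)
  rw [klDiv_of_ac_of_integrable hacσ hintσ, toReal_klDiv_of_measure_eq hac (by simp),
    integral_congr_ae hrn, integral_add hint hi2, integral_sub hΦ (integrable_const _)]
  congr 1
  simp only [integral_const, probReal_univ, smul_eq_mul]
  ring

/-- Bounds on the expectation of `logTensor` from the entropy inequality. -/
lemma exists_mul_integral_logTensor_le (hf : IsKacDensity f) :
    ∃ c : ℝ, ∀ n : ℕ, n ≠ 0 → slicedZ (fun v => ENNReal.ofReal (f v)) n ≠ 0 →
      ∀ (μ : Measure (Sphere (n + 2))) [IsProbabilityMeasure μ],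
      klDiv μ (conditioned f (n + 2)) ≠ ∞ → Integrable (logTensor f (n + 2)) μ ∧
      ∀ t : ℝ, |t| ≤ 1 / 2 → t * ∫ v, logTensor f (n + 2) v ∂μ ≤
        (klDiv μ (conditioned f (n + 2))).toReal + (c + n * logCgf f t - logSliced f n) := by
  obtain ⟨c, hc⟩ := hf.exists_lintegral_exp_conditioned_le
  refine ⟨c, fun n hn hz μ _ hkl => ?_⟩
  have := hf.isProbabilityMeasure_conditioned (hf.Z_ne_zero hz) (hf.Z_ne_top hn)
  obtain ⟨hac, hint⟩ := klDiv_ne_top_iff.1 hkl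
  have hm := hf.measurable_logTensor (n + 2)
  have key : ∀ t : ℝ, |t| ≤ 1 / 2 → _ := fun t ht =>
    exists_integrable_ge_of_lintegral_exp_le hac hint (Ψ := fun v => t * logTensor f (n + 2) v)
      (by fun_prop) (hc t ht n hn hz)
  -- The values t = 1/2 and t = -1/2 provide integrable upper and lower bounds.
  have hΦ : Integrable (logTensor f (n + 2)) μ := by
    obtain ⟨U, hU, hU', -⟩ := key (1 / 2) (by norm_num)
    obtain ⟨W, hW, hW', -⟩ := key (-(1 / 2)) (by norm_num)
    refine Integrable.mono' ((hU.norm.add hW.norm).const_mul 2) hm.aestronglyMeasurable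
      (ae_of_all _ fun v => ?_)
    have h1 := hU' v
    have h2 := hW' v
    simp only [Pi.add_apply, Real.norm_eq_abs]
    rw [abs_le]
    constructor <;> linarith [le_abs_self (U v), le_abs_self (W v), abs_nonneg (U v),
      abs_nonneg (W v)]
  refine ⟨hΦ, fun t ht => ?_⟩
  obtain ⟨U, hU, hU', hle⟩ := key t ht
  rw [toReal_klDiv_of_measure_eq hac (by simp), ← integral_const_mul]
  exact (integral_mono (hΦ.const_mul t) hU hU').trans hle

/-- Law of large numbers for `logTensor` under measures of small entropy relative to the
conditioned tensor product. -/
lemma tendsto_integral_logTensor (hf : IsKacDensity f) (μ : ∀ n : ℕ, Measure (Sphere (n + 2)))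
    [∀ n, IsProbabilityMeasure (μ n)]
    (hfin : ∀ᶠ n in atTop, klDiv (μ n) (conditioned f (n + 2)) ≠ ∞)
    (hH : Tendsto (fun n : ℕ => (klDiv (μ n) (conditioned f (n + 2))).toReal / ((n + 2 : ℕ) : ℝ))
      atTop (𝓝 0)) :
    Tendsto (fun n : ℕ => (∫ v, logTensor f (n + 2) v ∂μ n) / ((n + 2 : ℕ) : ℝ)) atTop
      (𝓝 (entropy f)) := by
  obtain ⟨c, hc⟩ := hf.exists_mul_integral_logTensor_le
  have hrat : Tendsto (fun n : ℕ => (n : ℝ) / ((n + 2 : ℕ) : ℝ)) atTop (𝓝 1) := by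
    simpa using tendsto_natCast_div_add_atTop (2 : ℝ)
  have hN : Tendsto (fun n : ℕ => ((n + 2 : ℕ) : ℝ)) atTop atTop :=
    tendsto_natCast_atTop_atTop.comp (tendsto_add_atTop_nat 2)
  set A : ℕ → ℝ := fun n => (∫ v, logTensor f (n + 2) v ∂μ n) / ((n + 2 : ℕ) : ℝ) with hA
  set B : ℝ → ℕ → ℝ := fun t n => (klDiv (μ n) (conditioned f (n + 2))).toReal / ((n + 2 : ℕ) : ℝ) +
    (c / ((n + 2 : ℕ) : ℝ) + (n : ℝ) / ((n + 2 : ℕ) : ℝ) * logCgf f t -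
      logSliced f n / n * ((n : ℝ) / ((n + 2 : ℕ) : ℝ))) with hB
  have hBlim : ∀ t, Tendsto (B t) atTop (𝓝 (logCgf f t)) := by
    intro t
    have := hH.add (((hN.const_div_atTop c).add (hrat.mul_const (logCgf f t))).sub
      (hf.tendsto_logSliced.mul hrat))
    simp only [zero_add, one_mul, zero_mul, sub_zero] at this
    exact this
  have hAB : ∀ t, |t| ≤ 1 / 2 → ∀ᶠ n in atTop, t * A n ≤ B t n := by
    intro t ht
    filter_upwards [hfin, hf.eventually_slicedZ_ne_zero, eventually_gt_atTop 0] with n h1 h2 h3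
    have h := (hc n h3.ne' h2 (μ n) h1).2 t ht
    have hn : (n : ℝ) ≠ 0 := by exact_mod_cast h3.ne'
    have hN0 : (0 : ℝ) < ((n + 2 : ℕ) : ℝ) := by positivity
    have h' := div_le_div_of_nonneg_right h hN0.le
    have e1 : t * A n = (t * ∫ v, logTensor f (n + 2) v ∂μ n) / ((n + 2 : ℕ) : ℝ) := by
      simp only [hA]; ring
    have e2 : B t n = ((klDiv (μ n) (conditioned f (n + 2))).toReal +
        (c + n * logCgf f t - logSliced f n)) / ((n + 2 : ℕ) : ℝ) := by
      simp only [hB]; field_simp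
    rw [e1, e2]
    exact h'
  have hslope := hf.tendsto_slope_logCgf
  rw [tendsto_order]
  constructor
  · intro a ha
    -- A fixed negative t is chosen before n grows; dividing t A ≤ Λ(t) + o(1) by it reverses the
    -- inequality and gives the lower bound. Positive t gives the upper one.
    have hev : ∀ᶠ t in 𝓝[<] (0 : ℝ), a < logCgf f t / t :=
      (hslope.mono_left (nhdsWithin_mono _ fun x hx => ne_of_lt hx)).eventually (lt_mem_nhds ha)
    obtain ⟨t, ⟨hta, ht1⟩, ht0⟩ := ((hev.and (mem_nhdsWithin_of_mem_nhds
      (Ioi_mem_nhds (show (-(1 / 2) : ℝ) < 0 by norm_num)))).and self_mem_nhdsWithin).exists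
    replace ht0 : t < 0 := ht0
    have htab : |t| ≤ 1 / 2 := by rw [abs_of_neg ht0]; linarith
    rw [lt_div_iff_of_neg ht0] at hta
    filter_upwards [hAB t htab, (hBlim t).eventually (gt_mem_nhds hta)] with n h1 h2
    nlinarith
  · intro a ha
    have hev : ∀ᶠ t in 𝓝[>] (0 : ℝ), logCgf f t / t < a :=
      (hslope.mono_left (nhdsWithin_mono _ fun x hx => ne_of_gt hx)).eventually (gt_mem_nhds ha)
    obtain ⟨t, ⟨hta, ht1⟩, ht0⟩ := ((hev.and (mem_nhdsWithin_of_mem_nhds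
      (Iio_mem_nhds (show (0 : ℝ) < 1 / 2 by norm_num)))).and self_mem_nhdsWithin).exists
    replace ht0 : 0 < t := ht0
    have htab : |t| ≤ 1 / 2 := by rw [abs_of_pos ht0]; linarith
    rw [div_lt_iff₀ ht0] at hta
    filter_upwards [hAB t htab, (hBlim t).eventually (gt_mem_nhds hta)] with n h1 h2
    nlinarith

end IsKacDensity

end Kac

end

/-! ### Conclusion -/

theorem mainTheorem4
    (f : ℝ → ℝ) (hf_meas : Measurable f) (hf_nonneg : ∀ v, 0 ≤ f v)
    (hf_mass : ∫ v, f v = 1)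
    (hf_second : ∫ v, f v * v ^ 2 = 1)
    (hf_fourth : Integrable (fun v => f v * v ^ 4))
    (hf_bdd : MemLp f ∞ volume)
    (μ : ∀ N : ℕ, Measure (Kac.Sphere N)) (hμ : ∀ N, IsProbabilityMeasure (μ N))
    (hH : Tendsto (fun N : ℕ => klDiv (μ N) (Kac.conditioned f N) / (N : ℝ≥0∞)) atTop (𝓝 0)) :
    Tendsto (fun N : ℕ => klDiv (μ N) (Kac.sigma N) / (N : ℝ≥0∞)) atTop
      (𝓝 (klDiv (Kac.densityMeasure f) (gaussianReal 0 1))) := by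
  have hf : Kac.IsKacDensity f := by
    refine ⟨hf_meas, hf_nonneg, hf_mass, hf_second, hf_fourth,
      max 1 (eLpNorm f ∞ volume).toReal, le_max_left _ _, ?_⟩
    have hlt : eLpNorm f ∞ volume ≠ ∞ := hf_bdd.2.ne
    rw [eLpNorm_exponent_top] at hlt ⊢
    filter_upwards [ae_le_eLpNormEssSup (f := f) (μ := volume)] with v hv
    refine le_max_of_le_right ?_
    have := ENNReal.toReal_mono hlt hv
    rw [toReal_enorm, Real.norm_of_nonneg (hf_nonneg v)] at this
    exact this
  -- Slicing out a circle needs two coordinates, hence N = n + 2.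
  rw [← tendsto_add_atTop_iff_nat 2] at hH ⊢
  have hN0 : ∀ n : ℕ, ((n + 2 : ℕ) : ℝ≥0∞) ≠ 0 := fun n => by simp
  have hNt : ∀ n : ℕ, ((n + 2 : ℕ) : ℝ≥0∞) ≠ ∞ := fun n => ENNReal.natCast_ne_top _
  -- Finiteness comes first because `toReal` sends ∞ to 0.
  have hfin : ∀ᶠ n in atTop, klDiv (μ (n + 2)) (Kac.conditioned f (n + 2)) ≠ ∞ := by
    filter_upwards [hH.eventually (gt_mem_nhds ENNReal.zero_lt_top)] with n hn h
    rw [h, ENNReal.top_div_of_ne_top (hNt n)] at hn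
    exact lt_irrefl _ hn
  have hHr : Tendsto (fun n : ℕ => (klDiv (μ (n + 2)) (Kac.conditioned f (n + 2))).toReal /
      ((n + 2 : ℕ) : ℝ)) atTop (𝓝 0) := by
    have := (ENNReal.tendsto_toReal ENNReal.zero_ne_top).comp hH
    simpa only [Function.comp_def, ENNReal.toReal_div, ENNReal.toReal_natCast,
      ENNReal.toReal_zero] using this
  have hA := hf.tendsto_integral_logTensor (fun n => μ (n + 2)) hfin hHr
  have hlim := (hHr.add hA).sub hf.tendsto_log_Z
  rw [hf.klDiv_gaussianReal]
  have hlim' := (ENNReal.continuous_ofReal.tendsto _).comp hlim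
  rw [zero_add, sub_neg_eq_add] at hlim'
  refine hlim'.congr' ?_
  obtain ⟨c, hc⟩ := hf.exists_mul_integral_logTensor_le
  filter_upwards [hfin, hf.eventually_slicedZ_ne_zero, eventually_gt_atTop 0] with n h1 h2 h3
  rw [hf.klDiv_sigma_eq (hf.Z_ne_zero h2) (hf.Z_ne_top h3.ne') h1 (hc n h3.ne' h2 _ h1).1,
    ← ENNReal.ofReal_natCast, ← ENNReal.ofReal_div_of_pos (by positivity), Function.comp_apply]
  congr 1
  ring
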